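/- Let $n,d,k\ge 0$ be integers and let the symmetric group $S_n$ act on $\mathcal H=(\mathbb C^d)^{\otimes n}$ by permuting the tensor factors. Let $\mathcal H_\times$ be the compact group of all unitaries on $\mathcal H$ that commute with $g^{\otimes n}$ for every $g\in\mathrm{SU}(d)$. By Schur–Weyl duality $\mathcal H=\bigoplus_\lambda 1_{m_\lambda}\otimes S^\lambda$ with pairwise inequivalent irreducible representations $S^\lambda$ of $S_n$ occurring with multiplicity $m_\lambda$, and $\mathcal H_\times$ consists of the operators $U=\bigoplus_\lambda I_{m_\lambda}\otimes U_\lambda$ with $U_\lambda\in\mathrm U(S^\lambda)$. Let $S\mathcal H_\times\subseteq\mathcal H_\times$ be the subgroup with trivial relative phases, that is, the subgroup of those $U$ with $\det U_\lambda=1$ for all $\lambda$; equivalently, the restriction of $U$ to every irreducible $S_n$-subrepresentation of $\mathcal H$ has determinant $1$. For a compact group $G$ of unitaries on $\mathcal H$ let $$T_k^G=\int_G U^{\otimes k}\otimes\bar U^{\otimes k}\,dU$$ be its $k$-th moment operator, where $dU$ is the normalized Haar measure of $G$. Suppose that $k<n-1$, that $d<n$ if $k\ge 1$, and that $(n,k)\neq(4,2)$.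 Then $S\mathcal H_\times$ is an $\mathrm{SU}(d)$-symmetric exact $k$-design: $$T_k^{S\mathcal H_\times}=T_k^{\mathcal H_\times}.$$ -/

import Mathlib

open scoped Kronecker ComplexConjugate

noncomputable section

namespace SymDesign

/-- The `n`-th tensor power `A ⊗ ⋯ ⊗ A` of a matrix `A`, in the product basis
`|x₁, …, xₙ⟩`, `x : Fin n → ι`. -/
def tensorPower {ι : Type*} (n : ℕ) (A : Matrix ι ι ℂ) :
    Matrix (Fin n → ι) (Fin n → ι) ℂ :=
  Matrix.of fun x y => ∏ i, A (x i) (y i)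

/-! ### The group of `SU(d)`-symmetric unitaries -/

/-- The labels of the computational basis of the `n`-qudit space `(ℂ^d)^{⊗ n}`; the space itself
is `Config n d → ℂ`. -/
abbrev Config (n d : ℕ) : Type := Fin n → Fin d

/-- The group of unitaries on `(ℂ^d)^{⊗ n}` which commute with `g^{⊗ n}` for every `g ∈ SU(d)`. -/
def symmetricUnitaries (n d : ℕ) : Subgroup (Matrix.unitaryGroup (Config n d) ℂ) where
  carrier := {U | ∀ g ∈ Matrix.specialUnitaryGroup (Fin d) ℂ,
    Commute (U : Matrix (Config n d) (Config n d) ℂ) (tensorPower n g)}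
  mul_mem' hU hV g hg := (hU g hg).mul_left (hV g hg)
  one_mem' g _ := Commute.one_left _
  inv_mem' := by
    intro U hU g hg
    have h := hU g hg
    have h1 : (U : Matrix (Config n d) (Config n d) ℂ) * ((U⁻¹ : Matrix.unitaryGroup _ ℂ) :
        Matrix (Config n d) (Config n d) ℂ) = 1 := by
      rw [← Submonoid.coe_mul, mul_inv_cancel, Submonoid.coe_one]
    have h2 : ((U⁻¹ : Matrix.unitaryGroup _ ℂ) : Matrix (Config n d) (Config n d) ℂ) *
        (U : Matrix (Config n d) (Config n d) ℂ) = 1 := by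
      rw [← Submonoid.coe_mul, inv_mul_cancel, Submonoid.coe_one]
    exact Commute.units_inv_left (u := ⟨_, _, h1, h2⟩) h

/-! ### The action of `S_n` and the subgroup with trivial relative phases -/

/-- The action of `S_n` on `(ℂ^d)^{⊗ n}` by permutation of the qudits; on basis vectors,
`σ |x₁, …, xₙ⟩ = |x_{σ⁻¹(1)}, …, x_{σ⁻¹(n)}⟩`. -/
def permRep (n d : ℕ) : Representation ℂ (Equiv.Perm (Fin n)) (Config n d → ℂ) where
  toFun σ := LinearMap.funLeft ℂ ℂ fun x : Config n d => x ∘ σ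
  map_one' := by ext; rfl
  map_mul' _ _ := by ext; rfl

/-- `U` preserves the subspace `W`, and its restriction to `W` has determinant `1`. -/
def HasDetOneOn {ι : Type*} [Fintype ι] [DecidableEq ι] (W : Submodule ℂ (ι → ℂ))
    (U : Matrix ι ι ℂ) : Prop :=
  ∃ h : ∀ v ∈ W, Matrix.toLin' U v ∈ W, LinearMap.det ((Matrix.toLin' U).restrict h) = 1

section HasDetOneOn

variable {ι : Type*} [Fintype ι] [DecidableEq ι] {W : Submodule ℂ (ι → ℂ)}

theorem HasDetOneOn.one : HasDetOneOn W (1 : Matrix ι ι ℂ) := by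
  refine ⟨fun v hv => by simpa using hv, ?_⟩
  have : (Matrix.toLin' (1 : Matrix ι ι ℂ)).restrict
      (fun v hv => by simpa using hv : ∀ v ∈ W, Matrix.toLin' (1 : Matrix ι ι ℂ) v ∈ W) =
      LinearMap.id := by
    ext; simp
  rw [this, LinearMap.det_id]

theorem HasDetOneOn.mul {U V : Matrix ι ι ℂ} (hU : HasDetOneOn W U) (hV : HasDetOneOn W V) :
    HasDetOneOn W (U * V) := by
  obtain ⟨hU, dU⟩ := hU
  obtain ⟨hV, dV⟩ := hV
  have h : ∀ v ∈ W, Matrix.toLin' (U * V) v ∈ W := fun v hv => by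
    rw [Matrix.toLin'_mul]; exact hU _ (hV _ hv)
  refine ⟨h, ?_⟩
  have : (Matrix.toLin' (U * V)).restrict h =
      (Matrix.toLin' U).restrict hU ∘ₗ (Matrix.toLin' V).restrict hV := by
    ext; simp [Matrix.toLin'_mul]
  rw [this, LinearMap.det_comp, dU, dV, one_mul]

theorem HasDetOneOn.inv {U V : Matrix ι ι ℂ} (hUV : U * V = 1) (hU : HasDetOneOn W U) :
    HasDetOneOn W V := by
  obtain ⟨hU, dU⟩ := hU
  have hVU : V * U = 1 := mul_eq_one_comm.mp hUV
  have hsurj : Function.Surjective ((Matrix.toLin' U).restrict hU) :=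
    ((LinearMap.isUnit_iff_range_eq_top _).mp
      ((LinearMap.isUnit_iff_isUnit_det _).mpr (by rw [dU]; exact isUnit_one))) |>
      LinearMap.range_eq_top.mp
  have h : ∀ v ∈ W, Matrix.toLin' V v ∈ W := by
    intro v hv
    obtain ⟨w, hw⟩ := hsurj ⟨v, hv⟩
    have hw' : Matrix.toLin' U w = v := congrArg Subtype.val hw
    rw [← hw', ← LinearMap.comp_apply, ← Matrix.toLin'_mul, hVU]
    simp
  refine ⟨h, ?_⟩
  have : (Matrix.toLin' U).restrict hU ∘ₗ (Matrix.toLin' V).restrict h = LinearMap.id := by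
    ext v : 2
    change Matrix.toLin' U (Matrix.toLin' V v) = v
    rw [← LinearMap.comp_apply, ← Matrix.toLin'_mul, hUV]
    simp
  have := congrArg LinearMap.det this
  rwa [LinearMap.det_comp, dU, one_mul, LinearMap.det_id] at this

end HasDetOneOn

/-- The group of `SU(d)`-symmetric unitaries with trivial relative phases. In the decomposition
`(ℂ^d)^{⊗ n} = ⨁_λ 1_{m_λ} ⊗ S^λ` into irreducible representations of `S_n`, the irreducible
subrepresentations are the copies `v ⊗ S^λ` of the sectors `S^λ`, and a symmetric unitary
`U = ⨁_λ 1 ⊗ U_λ` restricts to `U_λ` on each of them; the group is therefore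
`{⨁_λ 1 ⊗ U_λ | U_λ ∈ SU(S^λ) for all λ}`. -/
def specialSymmetricUnitaries (n d : ℕ) : Subgroup (Matrix.unitaryGroup (Config n d) ℂ) where
  carrier := {U | U ∈ symmetricUnitaries n d ∧
    ∀ W : Subrepresentation (permRep n d), W.toRepresentation.IsIrreducible →
      HasDetOneOn W.toSubmodule (U : Matrix (Config n d) (Config n d) ℂ)}
  mul_mem' hU hV := ⟨mul_mem hU.1 hV.1, fun W hW => (hU.2 W hW).mul (hV.2 W hW)⟩
  one_mem' := ⟨one_mem _, fun _ _ => HasDetOneOn.one⟩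
  inv_mem' {U} hU := ⟨inv_mem hU.1, fun W hW => (hU.2 W hW).inv (by
    rw [← Submonoid.coe_mul, mul_inv_cancel, Submonoid.coe_one])⟩

/-! ### Compactness -/

instance compactSpace_unitaryGroup {ι : Type*} [Fintype ι] [DecidableEq ι] :
    CompactSpace (Matrix.unitaryGroup ι ℂ) := by
  have hK : IsCompact {A : ι → ι → ℂ | ∀ i j, A i j ∈ Metric.closedBall (0 : ℂ) 1} := by
    have := isCompact_univ_pi (ι := ι) (X := fun _ => ι → ℂ)
      (s := fun _ => {a | ∀ j, a j ∈ Metric.closedBall (0 : ℂ) 1}) fun _ => by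
        have := isCompact_univ_pi (ι := ι) (X := fun _ => ℂ)
          (s := fun _ => Metric.closedBall (0 : ℂ) 1) fun _ => isCompact_closedBall 0 1
        simpa [Set.pi] using this
    simpa [Set.pi] using this
  have hcl : IsClosed (Matrix.unitaryGroup ι ℂ : Set (Matrix ι ι ℂ)) :=
    isClosed_unitary
  exact isCompact_iff_compactSpace.mp <| hK.of_isClosed_subset hcl fun U hU i j => by
    simpa using entry_norm_bound_of_unitary hU i j

theorem isClosed_symmetricUnitaries (n d : ℕ) :
    IsClosed (symmetricUnitaries n d : Set (Matrix.unitaryGroup (Config n d) ℂ)) := by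
  have : (symmetricUnitaries n d : Set (Matrix.unitaryGroup (Config n d) ℂ)) =
      ⋂ g ∈ Matrix.specialUnitaryGroup (Fin d) ℂ, {U : Matrix.unitaryGroup (Config n d) ℂ |
        (U : Matrix (Config n d) (Config n d) ℂ) * tensorPower n g = tensorPower n g * U} := by
    ext U
    simp only [Set.mem_iInter]
    rfl
  rw [this]
  exact isClosed_biInter fun g _ => isClosed_eq
    (continuous_subtype_val.mul continuous_const) (continuous_const.mul continuous_subtype_val)

theorem isClosed_hasDetOneOn {ι : Type*} [Fintype ι] [DecidableEq ι]
    (W : Submodule ℂ (ι → ℂ)) : IsClosed {U : Matrix ι ι ℂ | HasDetOneOn W U} := by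
  obtain ⟨p, hp⟩ := W.subtype.exists_leftInverse_of_injective (Submodule.ker_subtype W)
  let b := Module.finBasis ℂ W
  let c : Matrix ι ι ℂ →ₗ[ℂ] Matrix _ _ ℂ :=
    (LinearMap.toMatrix b b).toLinearMap ∘ₗ LinearMap.llcomp ℂ W (ι → ℂ) W p ∘ₗ
      LinearMap.lcomp ℂ (ι → ℂ) W.subtype ∘ₗ (Matrix.toLin' (R := ℂ)).toLinearMap
  have hc : Continuous c := c.continuous_of_finiteDimensional
  have key : ∀ (U : Matrix ι ι ℂ) (h : ∀ v ∈ W, Matrix.toLin' U v ∈ W),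
      LinearMap.det ((Matrix.toLin' U).restrict h) = (c U).det := by
    intro U h
    rw [← LinearMap.det_toMatrix b]
    have hr : (Matrix.toLin' U).restrict h = p ∘ₗ Matrix.toLin' U ∘ₗ W.subtype :=
      LinearMap.ext fun v => (LinearMap.congr_fun hp ((Matrix.toLin' U).restrict h v)).symm
    rw [hr]
    rfl
  have : {U : Matrix ι ι ℂ | HasDetOneOn W U} =
      (⋂ v ∈ W, {U : Matrix ι ι ℂ | Matrix.toLin' U v ∈ W}) ∩ {U | (c U).det = 1} := by
    ext U
    simp only [Set.mem_inter_iff, Set.mem_iInter, Set.mem_ofPred_eq]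
    constructor
    · rintro ⟨h, hd⟩
      exact ⟨h, (key U h).symm.trans hd⟩
    · rintro ⟨h, hd⟩
      exact ⟨h, (key U h).trans hd⟩
  rw [this]
  refine IsClosed.inter (isClosed_biInter fun v _ => ?_)
    (isClosed_eq hc.matrix_det continuous_const)
  exact W.closed_of_finiteDimensional.preimage
    (((LinearMap.applyₗ v : ((ι → ℂ) →ₗ[ℂ] (ι → ℂ)) →ₗ[ℂ] (ι → ℂ)) ∘ₗ
      (Matrix.toLin' (R := ℂ)).toLinearMap).continuous_of_finiteDimensional)

theorem isClosed_specialSymmetricUnitaries (n d : ℕ) :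
    IsClosed (specialSymmetricUnitaries n d : Set (Matrix.unitaryGroup (Config n d) ℂ)) := by
  have : (specialSymmetricUnitaries n d : Set (Matrix.unitaryGroup (Config n d) ℂ)) =
      (symmetricUnitaries n d : Set (Matrix.unitaryGroup (Config n d) ℂ)) ∩
      ⋂ (W : Subrepresentation (permRep n d)) (_ : W.toRepresentation.IsIrreducible),
        Subtype.val ⁻¹' {U : Matrix (Config n d) (Config n d) ℂ |
          HasDetOneOn W.toSubmodule U} := by
    ext U
    simp only [Set.mem_inter_iff, Set.mem_iInter]
    rfl
  rw [this]
  exact (isClosed_symmetricUnitaries n d).inter <| isClosed_iInter fun W => isClosed_iInter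
    fun _ => (isClosed_hasDetOneOn _).preimage continuous_subtype_val

instance compactSpace_symmetricUnitaries (n d : ℕ) : CompactSpace (symmetricUnitaries n d) :=
  isCompact_iff_compactSpace.mp (isClosed_symmetricUnitaries n d).isCompact

instance compactSpace_specialSymmetricUnitaries (n d : ℕ) :
    CompactSpace (specialSymmetricUnitaries n d) :=
  isCompact_iff_compactSpace.mp (isClosed_specialSymmetricUnitaries n d).isCompact

/-! ### Moment operators -/

/-- Subgroups of the unitary group carry their Borel σ-algebra. -/
instance measurableSpace_subgroup {ι : Type*} [Fintype ι] [DecidableEq ι]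
    (G : Subgroup (Matrix.unitaryGroup ι ℂ)) : MeasurableSpace G := borel G

instance borelSpace_subgroup {ι : Type*} [Fintype ι] [DecidableEq ι]
    (G : Subgroup (Matrix.unitaryGroup ι ℂ)) : BorelSpace G := ⟨rfl⟩

/-- The Haar measure of a compact group of unitaries, normalized to total mass `1`. -/
def haarProb {ι : Type*} [Fintype ι] [DecidableEq ι]
    (G : Subgroup (Matrix.unitaryGroup ι ℂ)) [CompactSpace G] : MeasureTheory.Measure G :=
  MeasureTheory.Measure.haarMeasure ⊤

/-- The `k`-th moment operator `T_k^G = ∫_G U^{⊗ k} ⊗ Ū^{⊗ k} dU` of a compact group `G` of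
unitaries, where `dU` is the normalized Haar measure of `G` and `Ū` is the entrywise complex
conjugate of `U`. The integral is taken entry by entry. -/
def momentOperator {ι : Type*} [Fintype ι] [DecidableEq ι] (k : ℕ)
    (G : Subgroup (Matrix.unitaryGroup ι ℂ)) [CompactSpace G] :
    Matrix ((Fin k → ι) × (Fin k → ι)) ((Fin k → ι) × (Fin k → ι)) ℂ :=
  Matrix.of fun a b => ∫ U : G,
    (tensorPower k (U : Matrix ι ι ℂ) ⊗ₖ tensorPower k ((U : Matrix ι ι ℂ).map conj)) a b
      ∂(haarProb G)

end SymDesign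

end

noncomputable section

namespace SymDesign

/-! ### Representations of the symmetric group of small dimension -/

section SmallDimension

open Equiv

variable {α : Type*} {V : Type*} [AddCommGroup V] [Module ℂ V]
  (ρ : Representation ℂ (Perm α) V)

/-! Every symmetric unitary is a special one up to a phase on each isotypic component: on a
component of type `W`, choose a `dim W`-th root of the inverse determinant
(`exists_phaseUnitary_mul_mem`). Two compact groups, one inside the other, have the same moment
operator once that of the smaller is invariant under the larger (`momentOperator_eq_of_le`). So it
suffices that the moment operator `T` of the special group absorbs all phases.

In a basis of vectors lying in irreducible subspaces, a phase unitary acts on the `k`-fold moment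
space diagonally. Its entry at a pair of words `I`, `J` of basis labels is the weight `∏ ζ(I_l) ∏
conj ζ(J_l)`. As `T` absorbs the phases with `ζ(W)^(dim W) = 1`, in this basis only columns whose
weight is trivial on such phases survive. Testing with a primitive `dim W`-th root of unity on one
component shows that `W` occurs equally often in `I` and `J`, provided `dim W > k`
(`card_filter_eq_of_special`). If at most one component has dimension `≤ k`, its two multiplicities
agree as well, because both words have length `k`. The weight is then trivial on all phases
(`weight_eq_one`).

It remains to see that only the trivial representation can be a component of dimension `≤ k`
(`permRep_apply_eq_self`). For `n ≥ 5`, all transpositions act alike on a representation of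
dimension `≤ n - 2` (`rep_swap_eq_of_five_le`); in dimension `1` this holds for every `n`. When `d <
n`, each basis word repeats a letter, hence is fixed by some transposition, so this common action is
the identity and the sign representation cannot occur. The excluded case `(4,2)` is that of the
two-dimensional irreducible representation of `S_4`.

The statement on transpositions is proved by induction on the degree. If an eigenspace of a
transposition is at most a line, the transposition acts as a reflection up to sign, and reflections
force the standard representation, of dimension `n - 1`. Otherwise both eigenspaces are small enough
for induction to apply to the symmetric group on the remaining letters.

Schur–Weyl duality (`Equivariant.commute`) gives access to the symmetric unitaries: they commute
with the whole commutant of `S_n`, hence preserve every irreducible subspace and act compatibly on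
isomorphic ones. -/

theorem rep_mul_apply (g h : Perm α) (x : V) : ρ (g * h) x = ρ g (ρ h x) := by
  rw [map_mul]; rfl

variable [DecidableEq α]

theorem rep_swap_swap (a b : α) (x : V) : ρ (swap a b) (ρ (swap a b) x) = x := by
  rw [← rep_mul_apply, swap_mul_self, map_one]; rfl

/-- The transpositions in a representation are conjugate, so one of them is a scalar only if all
of them are the same scalar. -/
theorem rep_swap_eq_of_eq_smul {a b : α} (hab : a ≠ b) {c : ℂ}
    (h : ρ (swap a b) = c • LinearMap.id) {a' b' : α} (hab' : a' ≠ b') :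
    ρ (swap a' b') = c • LinearMap.id := by
  obtain ⟨g, hg⟩ := isConj_iff.mp (Perm.isConj_swap hab hab')
  rw [← hg, map_mul, map_mul, h]
  ext x
  simp only [Module.End.mul_apply, LinearMap.smul_apply, LinearMap.id_apply, map_smul]
  rw [← rep_mul_apply, mul_inv_cancel, map_one]; rfl

/-- Transpositions are conjugate already in the symmetric group of the complement of `{a, b}`. -/
theorem exists_perm_fixing_conj_swap {a b c d j k : α} (hcd : c ≠ d) (hjk : j ≠ k)
    (hc : c ≠ a ∧ c ≠ b) (hd : d ≠ a ∧ d ≠ b) (hj : j ≠ a ∧ j ≠ b) (hk : k ≠ a ∧ k ≠ b) :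
    ∃ g : Perm α, g * swap a b * g⁻¹ = swap a b ∧ g * swap j k * g⁻¹ = swap c d := by
  let p : α → Prop := fun x => x ≠ a ∧ x ≠ b
  obtain ⟨g, hg⟩ := isConj_iff.mp (Perm.isConj_swap (α := Subtype p)
    (w := ⟨j, hj⟩) (x := ⟨k, hk⟩) (y := ⟨c, hc⟩) (z := ⟨d, hd⟩)
    (by simpa using hjk) (by simpa using hcd))
  refine ⟨Perm.ofSubtype g, ?_, ?_⟩
  · rw [mul_swap_eq_swap_mul, Perm.ofSubtype_apply_of_not_mem g (by simp [p]),
      Perm.ofSubtype_apply_of_not_mem g (by simp [p]), mul_inv_cancel_right]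
  · have := congrArg Perm.ofSubtype hg
    simpa [Perm.ofSubtype_swap_eq] using this

theorem rep_swap_eq_of_finrank_le_one [FiniteDimensional ℂ V] (hdim : Module.finrank ℂ V ≤ 1)
    {a b c d : α} (hab : a ≠ b) (hcd : c ≠ d) : ρ (swap a b) = ρ (swap c d) := by
  obtain ⟨v, hv⟩ := finrank_le_one_iff.mp hdim
  obtain ⟨r, hr⟩ := hv (ρ (swap a b) v)
  have h : ρ (swap a b) = r • LinearMap.id := by
    ext x
    obtain ⟨s, rfl⟩ := hv x
    rw [map_smul, ← hr, LinearMap.smul_apply, LinearMap.id_apply, smul_comm]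
  rw [h, rep_swap_eq_of_eq_smul ρ hab h hcd]

variable [Fintype α]

/-- The pointwise stabilizer of `a` and `b` is the symmetric group on the other letters, which is
generated by transpositions. -/
theorem rep_fixes_of_swap_fixes {a b : α} {v : V}
    (h : ∀ j k, j ≠ k → (j ≠ a ∧ j ≠ b) → (k ≠ a ∧ k ≠ b) → ρ (swap j k) v = v)
    {σ : Perm α} (ha : σ a = a) (hb : σ b = b) : ρ σ v = v := by
  let p : α → Prop := fun x => x ≠ a ∧ x ≠ b
  have hp : ∀ x, p x ↔ p (σ x) := fun x => by
    have h1 : σ x = a ↔ x = a := by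
      conv_lhs => rw [← ha, σ.injective.eq_iff]
    have h2 : σ x = b ↔ x = b := by
      conv_lhs => rw [← hb, σ.injective.eq_iff]
    simp only [p, ne_eq, h1, h2]
  have hσ : σ = Perm.ofSubtype (σ.subtypePerm (p := p) fun x => (hp x).symm) := by
    rw [Perm.ofSubtype_subtypePerm]
    intro x hx
    exact ⟨fun e => hx (e ▸ ha), fun e => hx (e ▸ hb)⟩
  rw [hσ]
  generalize σ.subtypePerm (p := p) _ = τ
  induction τ using Perm.swap_induction_on with
  | one => simp
  | swap_mul f x y hxy ih =>
    rw [map_mul, rep_mul_apply, ih, Perm.ofSubtype_swap_eq]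
    exact h _ _ (by simpa [Subtype.ext_iff] using hxy) x.2 y.2

/-- If the transpositions act as reflections and disjoint transpositions act differently, then
the representation has dimension at least `card α - 1`. -/
theorem card_le_finrank_add_one_of_reflection [FiniteDimensional ℂ V] {a b c d : α} (hab : a ≠ b)
    (hcd : c ≠ d) (hc : c ≠ a ∧ c ≠ b) (hd : d ≠ a ∧ d ≠ b) {v : V}
    (hv : v ≠ 0) (hvneg : ρ (swap a b) v = -v)
    (hspan : ∀ x, ∃ r : ℂ, ρ (swap a b) x = x + r • v)
    (hfix : ∀ j k, j ≠ k → (j ≠ a ∧ j ≠ b) → (k ≠ a ∧ k ≠ b) → ρ (swap j k) v = v) :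
    Fintype.card α ≤ Module.finrank ℂ V + 1 := by
  -- The model is the standard representation, with `v = e_a - e_b` and `B j = e_a - e_j`. The goal
  -- is that the `card α - 1` vectors `B j`, `j ≠ a`, are linearly independent.
  set B : α → V := fun j => ρ (swap b j) v with hB
  have hBb : B b = v := by simp only [hB, swap_self]; exact LinearMap.congr_fun ρ.map_one v
  -- The stabilizer of `a` permutes the vectors `B l`, because `(b σl) σ (b l)` fixes both `a` and
  -- `b`, hence fixes `v`.
  have hperm : ∀ (σ : Perm α) (l : α), σ a = a → l ≠ a → ρ σ (B l) = B (σ l) := by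
    intro σ l ha hl
    have key : ρ (swap b (σ l) * (σ * swap b l)) v = v := by
      apply rep_fixes_of_swap_fixes ρ hfix
      · have h1 : swap b l a = a := swap_apply_of_ne_of_ne hab hl.symm
        have h2 : σ l ≠ a := fun e => hl (σ.injective (e.trans ha.symm))
        simp [Perm.mul_apply, h1, ha, swap_apply_of_ne_of_ne hab h2.symm]
      · simp [Perm.mul_apply]
    rw [rep_mul_apply, rep_mul_apply] at key
    have := congrArg (ρ (swap b (σ l))) key
    rwa [rep_swap_swap] at this
  have hswapconj : ∀ l, l ≠ a → l ≠ b →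
      swap a l = swap b l * swap a b * swap b l ∧ swap b l = swap a b * swap a l * swap a b := by
    intro l hla hlb
    constructor
    · rw [mul_swap_eq_swap_mul (swap b l) a b, swap_apply_of_ne_of_ne hab hla.symm,
        swap_apply_left, mul_assoc, swap_mul_self, mul_one]
    · rw [mul_swap_eq_swap_mul (swap a b) a l, swap_apply_left, swap_apply_of_ne_of_ne hla hlb,
        mul_assoc, swap_mul_self, mul_one]
  have hne : ∀ l, l ≠ a → l ≠ b → B l ≠ v := by
    intro l hla hlb e
    have e1 : ρ (swap a l) v = -v := by
      change ρ (swap b l) v = v at e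
      rw [(hswapconj l hla hlb).1, rep_mul_apply, rep_mul_apply, e, hvneg, map_neg, e]
    have e2 : ρ (swap b l) v = -v := by
      rw [(hswapconj l hla hlb).2, rep_mul_apply, rep_mul_apply, hvneg, map_neg, e1, neg_neg, hvneg]
    have : v = -v := e.symm.trans e2
    have h2 : (2 : ℂ) • v = 0 := by rw [two_smul]; nth_rewrite 1 [this]; exact neg_add_cancel v
    exact hv ((smul_eq_zero.mp h2).resolve_left two_ne_zero)
  have hinj : ∀ j k, j ≠ a → k ≠ a → j ≠ k → B j ≠ B k := by
    intro j k hj hk hjk e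
    have hfa : swap j b a = a := swap_apply_of_ne_of_ne hj.symm hab
    have h2 := congrArg (ρ (swap j b)) e
    rw [hperm _ _ hfa hj, hperm _ _ hfa hk, swap_apply_left, hBb] at h2
    refine hne (swap j b k) ?_ ?_ h2.symm
    · intro h; exact hk ((swap j b).injective (h.trans hfa.symm))
    · intro h; exact hjk ((swap j b).injective (by rw [h, swap_apply_left]))
  -- The coefficient of `v` is the same for all `j ≠ a, b`, by conjugation with `(c j)`. In the
  -- model it is `-1`.
  obtain ⟨μ, hμ⟩ := hspan (B c)
  have hμ' : ∀ j, j ≠ a → j ≠ b → ρ (swap a b) (B j) = B j + μ • v := by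
    intro j hja hjb
    have hfa : swap c j a = a := swap_apply_of_ne_of_ne hc.1.symm hja.symm
    have hfb : swap c j b = b := swap_apply_of_ne_of_ne hc.2.symm hjb.symm
    have h2 := congrArg (ρ (swap c j)) hμ
    rw [← rep_mul_apply, mul_swap_eq_swap_mul, hfa, hfb, rep_mul_apply, map_add, map_smul,
      hperm _ _ hfa hc.1, swap_apply_left] at h2
    rw [h2, ← hBb, hperm _ _ hfa hab.symm, hfb]
  -- Two expressions for `B c`, through the braid relations between `(a b)`, `(a c)` and `(b c)`,
  -- give `(1 + μ)(B c - (1 - μ)v) = 0`. If `μ ≠ -1`, then `B c` is a multiple of `v`, hence fixed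
  -- by `(c d)`, and `B d = B c`, which is impossible.
  have hμ1 : 1 + μ = 0 := by
    by_contra hne1
    have e1 : ρ (swap a c) v = v + μ • B c := by
      rw [(hswapconj c hc.1 hc.2).1, rep_mul_apply, rep_mul_apply]
      change ρ (swap b c) (ρ (swap a b) (B c)) = _
      rw [hμ, map_add, map_smul]
      change ρ (swap b c) (ρ (swap b c) v) + _ = _
      rw [rep_swap_swap]
    have e2 : B c = v - μ • B c - (μ * μ) • v := by
      change ρ (swap b c) v = _
      rw [(hswapconj c hc.1 hc.2).2, rep_mul_apply, rep_mul_apply, hvneg, map_neg, e1, map_neg,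
        map_add, map_smul, hvneg, hμ]
      module
    have e3 : (1 + μ) • (B c - (1 - μ) • v) = 0 := by
      calc (1 + μ) • (B c - (1 - μ) • v) = B c - (v - μ • B c - (μ * μ) • v) := by module
        _ = 0 := sub_eq_zero.mpr e2
    have e4 : B c = (1 - μ) • v :=
      sub_eq_zero.mp ((smul_eq_zero.mp e3).resolve_left hne1)
    have hfa : swap c d a = a := swap_apply_of_ne_of_ne hc.1.symm hd.1.symm
    have e5 := congrArg (ρ (swap c d)) e4
    rw [hperm _ _ hfa hc.1, swap_apply_left, map_smul, hfix c d hcd hc hd, ← e4] at e5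
    exact hinj d c hd.1 hc.1 hcd.symm e5
  have hμ2 : μ = -1 := by linear_combination hμ1
  have hli : LinearIndependent ℂ (fun j : {j // j ≠ a} => B j) := by
    rw [Fintype.linearIndependent_iff]
    intro w hw
    -- Apply `(j k)` to the relation and subtract: only the terms at `j` and `k` remain, so all
    -- coefficients are equal.
    have hweq : ∀ j k, j ≠ k → w j = w k := by
      intro j k hjk
      have hfa : swap (j : α) k a = a := swap_apply_of_ne_of_ne j.2.symm k.2.symm
      have h1 : ∑ l, w l • (B (swap (j : α) k l) - B l) = 0 := by
        have := congrArg (ρ (swap (j : α) k)) hw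
        rw [map_sum, map_zero] at this
        simp only [smul_sub, Finset.sum_sub_distrib, hw, sub_zero]
        rw [← this]
        exact Finset.sum_congr rfl fun l _ => by rw [map_smul, hperm _ _ hfa l.2]
      rw [Fintype.sum_eq_add j k hjk, swap_apply_left, swap_apply_right] at h1
      · have h2 : (w j - w k) • (B k - B j) = 0 := by rw [← h1]; module
        refine sub_eq_zero.mp ((smul_eq_zero.mp h2).resolve_right ?_)
        exact sub_ne_zero.mpr (hinj k j k.2 j.2 fun e => hjk (Subtype.ext e.symm))
      · rintro x ⟨hxj, hxk⟩
        rw [swap_apply_of_ne_of_ne (fun e => hxj (Subtype.ext e)) (fun e => hxk (Subtype.ext e)),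
          sub_self, smul_zero]
    let b' : {j // j ≠ a} := ⟨b, hab.symm⟩
    have hwb : ∀ j, w j = w b' := fun j => by
      by_cases h : j = b'
      · rw [h]
      · exact hweq j b' h
    suffices h0 : w b' = 0 from fun j => (hwb j).trans h0
    have h1 : w b' • ∑ l : {j // j ≠ a}, B l = 0 := by
      rw [Finset.smul_sum, ← hw]
      exact Finset.sum_congr rfl fun l _ => by rw [hwb l]
    refine (smul_eq_zero.mp h1).resolve_right fun hsum => hv ?_
    -- The sum of the `B l` cannot vanish, since `1 - (a b)` maps it to `(card α) • v`: one `v` from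
    -- each of the `card α - 1` terms, and a second one from `B b = v`.
    have h2 : ∑ l : {j // j ≠ a}, (B l - ρ (swap a b) (B l)) = 0 := by
      rw [Finset.sum_sub_distrib, ← map_sum, hsum, map_zero, sub_zero]
    have h3 : ∀ l : {j // j ≠ a},
        B l - ρ (swap a b) (B l) = v + if l = b' then v else 0 := by
      intro l
      by_cases h : l = b'
      · rw [if_pos h, h]; change B b - ρ (swap a b) (B b) = _
        rw [hBb, hvneg, sub_neg_eq_add]
      · rw [if_neg h, hμ' l l.2 (fun e => h (Subtype.ext e)), hμ2]; module
    simp only [h3, Finset.sum_add_distrib, Finset.sum_const, Finset.sum_ite_eq', Finset.mem_univ,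
      if_true] at h2
    rw [← succ_nsmul, ← Nat.cast_smul_eq_nsmul ℂ] at h2
    exact (smul_eq_zero.mp h2).resolve_left (Nat.cast_ne_zero.mpr (Nat.succ_ne_zero _))
  have hcard := hli.fintype_card_le_finrank
  rw [Fintype.card_subtype_compl, Fintype.card_subtype_eq] at hcard
  omega

/-- If the conclusion fails, `(a b)` is a genuine reflection with root `v`. A disjoint transposition
commutes with it and so maps `v` to `v` or `-v`. The sign `-1` would make the two reflections equal,
and conjugation would carry this to `(c d)`; hence `v` is fixed, and the dimension bound for
reflections is contradicted. -/
theorem rep_swap_eq_of_reflection [FiniteDimensional ℂ V]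
    (hdim : Module.finrank ℂ V + 2 ≤ Fintype.card α) {a b c d : α} (hab : a ≠ b)
    (hcd : c ≠ d) (hc : c ≠ a ∧ c ≠ b) (hd : d ≠ a ∧ d ≠ b)
    (hrank : ∀ j k : α, j ≠ k → ∃ v : V, ∀ x, ∃ r : ℂ, ρ (swap j k) x = x + r • v) :
    ρ (swap a b) = ρ (swap c d) := by
  by_contra hne
  obtain ⟨v, hspan⟩ := hrank a b hab
  by_cases htriv : ∀ x, ρ (swap a b) x = x
  · have h1 : ρ (swap a b) = (1 : ℂ) • LinearMap.id := by ext x; simp [htriv]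
    exact hne (h1.trans (rep_swap_eq_of_eq_smul ρ hab h1 hcd).symm)
  obtain ⟨x₀, hx₀⟩ := not_forall.mp htriv
  obtain ⟨r₀, hr₀⟩ := hspan x₀
  have hr₀0 : r₀ ≠ 0 := fun e => hx₀ (by rw [hr₀, e, zero_smul, add_zero])
  have hv : v ≠ 0 := fun e => hx₀ (by rw [hr₀, e, smul_zero, add_zero])
  have hvneg : ρ (swap a b) v = -v := by
    have h1 : r₀ • v = ρ (swap a b) x₀ - x₀ := by rw [hr₀]; module
    have h2 := congrArg (ρ (swap a b)) h1
    rw [map_smul, map_sub, rep_swap_swap, ← neg_sub, ← h1, ← smul_neg] at h2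
    exact smul_right_injective V hr₀0 h2
  have hfix : ∀ j k, j ≠ k → (j ≠ a ∧ j ≠ b) → (k ≠ a ∧ k ≠ b) → ρ (swap j k) v = v := by
    intro j k hjk hj hk
    have hcomm : ∀ x, ρ (swap a b) (ρ (swap j k) x) = ρ (swap j k) (ρ (swap a b) x) := by
      intro x
      rw [← rep_mul_apply, ← rep_mul_apply, mul_swap_eq_swap_mul,
        swap_apply_of_ne_of_ne hj.1 hj.2, swap_apply_of_ne_of_ne hk.1 hk.2]
    obtain ⟨r, hr⟩ := hspan (ρ (swap j k) v)
    rw [hcomm, hvneg, map_neg] at hr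
    set s : ℂ := -r / 2 with hs
    have h1 : ρ (swap j k) v = s • v := by
      have h2 : (2 : ℂ) • ρ (swap j k) v = (2 : ℂ) • (s • v) := by
        have h3 : (2 : ℂ) • ρ (swap j k) v =
            ((ρ (swap j k) v + r • v) + ρ (swap j k) v) - r • v := by module
        rw [h3, ← hr, hs]; module
      exact smul_right_injective V two_ne_zero h2
    have hss : s * s = 1 := by
      have h2 := rep_swap_swap ρ j k v
      rw [h1, map_smul, h1, smul_smul] at h2
      have h3 : (s * s - 1) • v = 0 := by rw [sub_smul, h2, one_smul, sub_self]
      exact sub_eq_zero.mp ((smul_eq_zero.mp h3).resolve_right hv)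
    rcases mul_self_eq_one_iff.mp hss with h | h
    · rw [h1, h, one_smul]
    exfalso
    have hneg : ρ (swap j k) v = -v := by rw [h1, h, neg_one_smul]
    -- Both transpositions now move each vector along `v` and negate `v`. Two such maps which
    -- commute are equal.
    have heq : ρ (swap a b) = ρ (swap j k) := by
      obtain ⟨u, hu⟩ := hrank j k hjk
      obtain ⟨r₁, hr₁⟩ := hu v
      have hr₁v : r₁ • u = (-2 : ℂ) • v := by
        rw [hneg] at hr₁
        have : r₁ • u = (v + r₁ • u) - v := by module
        rw [this, ← hr₁]; module
      have hr₁0 : r₁ ≠ 0 := by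
        rintro rfl
        rw [zero_smul] at hr₁v
        exact hv ((smul_eq_zero.mp hr₁v.symm).resolve_left (by norm_num))
      ext x
      obtain ⟨f, hf⟩ := hspan x
      obtain ⟨g', hg'⟩ := hu x
      obtain ⟨g, hg⟩ : ∃ g : ℂ, ρ (swap j k) x = x + g • v := by
        refine ⟨g' * r₁⁻¹ * (-2), ?_⟩
        rw [hg', mul_smul, ← hr₁v, smul_smul, mul_assoc, inv_mul_cancel₀ hr₁0, mul_one]
      have h2 := hcomm x
      rw [hg, hf, map_add, map_add, map_smul, map_smul, hf, hg, hvneg, hneg] at h2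
      have h3 : (2 * (f - g)) • v = 0 := by
        have : (2 * (f - g)) • v = (x + f • v + g • -v) - (x + g • v + f • -v) := by module
        rw [this, h2, sub_self]
      have h4 : f = g := by
        have := (smul_eq_zero.mp h3).resolve_right hv
        linear_combination this / 2
      rw [hf, hg, h4]
    obtain ⟨g, hg1, hg2⟩ := exists_perm_fixing_conj_swap hcd hjk hc hd hj hk
    apply hne
    rw [← hg1, ← hg2, map_mul, map_mul, map_mul, map_mul, heq]
  have := card_le_finrank_add_one_of_reflection ρ hab hcd hc hd hv hvneg hspan hfix
  omega

/-- The image of `s - 1`, for an involution `s`, lies in its `-1`-eigenspace. A bound on one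
transposition therefore makes every conjugate the identity plus a map of rank at most one. -/
theorem rep_swap_eq_of_finrank_eigenspace_le_one [FiniteDimensional ℂ V]
    (hdim : Module.finrank ℂ V + 2 ≤ Fintype.card α) {a b c d e f : α} (hab : a ≠ b)
    (hcd : c ≠ d) (hc : c ≠ a ∧ c ≠ b) (hd : d ≠ a ∧ d ≠ b) (hef : e ≠ f)
    (hrank : Module.finrank ℂ (LinearMap.ker (ρ (swap e f) + 1)) ≤ 1) :
    ρ (swap a b) = ρ (swap c d) := by
  refine rep_swap_eq_of_reflection ρ hdim hab hcd hc hd fun j k hjk => ?_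
  obtain ⟨v, hv⟩ := finrank_le_one_iff.mp hrank
  obtain ⟨g, hg⟩ := isConj_iff.mp (Perm.isConj_swap hef hjk)
  refine ⟨ρ g v, fun x => ?_⟩
  have hmem : ρ (swap e f) (ρ g⁻¹ x) - ρ g⁻¹ x ∈ LinearMap.ker (ρ (swap e f) + 1) := by
    rw [LinearMap.mem_ker, LinearMap.add_apply, map_sub, rep_swap_swap, Module.End.one_apply]
    abel
  obtain ⟨r, hr⟩ := hv ⟨_, hmem⟩
  refine ⟨r, ?_⟩
  have hr' : r • (v : V) = ρ (swap e f) (ρ g⁻¹ x) - ρ g⁻¹ x := congrArg Subtype.val hr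
  rw [← map_smul, hr', map_sub, ← hg, rep_mul_apply, rep_mul_apply, ← rep_mul_apply ρ g g⁻¹,
    mul_inv_cancel, map_one, Module.End.one_apply]
  abel

/-- The representation obtained from `ρ` by twisting with the sign character. -/
def signTwist : Representation ℂ (Perm α) V where
  toFun σ := ((Perm.sign σ : ℤ) : ℂ) • ρ σ
  map_one' := by simp
  map_mul' σ τ := by
    ext x
    simp only [map_mul, Units.val_mul, Int.cast_mul, LinearMap.smul_apply, Module.End.mul_apply,
      map_smul, mul_smul]
    rw [smul_comm]

theorem signTwist_swap {a b : α} (hab : a ≠ b) : signTwist ρ (swap a b) = -ρ (swap a b) := by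
  simp [signTwist, Perm.sign_swap hab]

/-- The representation of the symmetric group of `{x // p x}` on a subspace which is stable under
the permutations supported on `{x // p x}`. -/
def restrictSubtype (p : α → Prop) [DecidablePred p] (E : Submodule ℂ V)
    (hE : ∀ (g : Perm (Subtype p)), ∀ v ∈ E, ρ (Perm.ofSubtype g) v ∈ E) :
    Representation ℂ (Perm (Subtype p)) E where
  toFun g := (ρ (Perm.ofSubtype g)).restrict (hE g)
  map_one' := by ext; simp
  map_mul' g h := by ext; simp

/-- In a representation of dimension at most `card α - 2`, all disjoint transpositions act in
the same way. -/
theorem rep_swap_eq_of_finrank_le (N : ℕ) : ∀ {α : Type*} [Fintype α] [DecidableEq α]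
    {V : Type*} [AddCommGroup V] [Module ℂ V] [FiniteDimensional ℂ V]
    (ρ : Representation ℂ (Perm α) V), Fintype.card α = N → Module.finrank ℂ V + 2 ≤ N →
    ∀ {a b c d : α}, a ≠ b → c ≠ d → (c ≠ a ∧ c ≠ b) → (d ≠ a ∧ d ≠ b) →
    ρ (swap a b) = ρ (swap c d) := by
  induction N using Nat.strong_induction_on with
  | _ N ih =>
  intro α _ _ V _ _ _ ρ hN hdim a b c d hab hcd hc hd
  have hneg : ∀ {e f : α}, e ≠ f → Module.finrank ℂ (LinearMap.ker (ρ (swap e f) + 1)) ≤ 1 →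
      ρ (swap a b) = ρ (swap c d) := fun hef h =>
    rep_swap_eq_of_finrank_eigenspace_le_one ρ (hN ▸ hdim) hab hcd hc hd hef h
  have hpos : ∀ {e f : α}, e ≠ f → Module.finrank ℂ (LinearMap.ker (ρ (swap e f) - 1)) ≤ 1 →
      ρ (swap a b) = ρ (swap c d) := fun {e f} hef h => by
    have := rep_swap_eq_of_finrank_eigenspace_le_one (signTwist ρ) (hN ▸ hdim) hab hcd hc hd hef
      (by
        rw [signTwist_swap ρ hef]
        have : LinearMap.ker (-ρ (swap e f) + 1) = LinearMap.ker (ρ (swap e f) - 1) := by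
          rw [← LinearMap.ker_neg]; congr 1; abel
        rwa [this])
    rwa [signTwist_swap ρ hab, signTwist_swap ρ hcd, neg_inj] at this
  have hsum : ∀ e f : α, Module.finrank ℂ (LinearMap.ker (ρ (swap e f) + 1)) +
      Module.finrank ℂ (LinearMap.ker (ρ (swap e f) - 1)) ≤ Module.finrank ℂ V := by
    intro e f
    refine Submodule.finrank_add_finrank_le_of_disjoint ?_
    rw [Submodule.disjoint_def]
    intro x h1 h2
    rw [LinearMap.mem_ker, LinearMap.add_apply, Module.End.one_apply] at h1
    rw [LinearMap.mem_ker, LinearMap.sub_apply, Module.End.one_apply] at h2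
    have : (2 : ℂ) • x = (ρ (swap e f) x + x) - (ρ (swap e f) x - x) := by module
    rw [h1, h2, sub_zero] at this
    exact (smul_eq_zero.mp this).resolve_left two_ne_zero
  -- In this range `dim V ≤ 3`, so one of the two eigenspaces has dimension at most `1`.
  by_cases hN6 : N < 6
  · have := hsum a b
    by_cases h : Module.finrank ℂ (LinearMap.ker (ρ (swap a b) + 1)) ≤ 1
    · exact hneg hab h
    · exact hpos hab (by omega)
  obtain ⟨e, he⟩ : ∃ e, e ∉ ({a, b, c, d} : Finset α) := by
    by_contra! h
    have : Finset.univ.card ≤ ({a, b, c, d} : Finset α).card :=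
      Finset.card_le_card fun x _ => h x
    have := Finset.card_le_four (a := a) (b := b) (c := c) (d := d)
    rw [Finset.card_univ] at *
    omega
  obtain ⟨f, hf⟩ : ∃ f, f ∉ ({e, a, b, c, d} : Finset α) := by
    by_contra! h
    have : Finset.univ.card ≤ ({e, a, b, c, d} : Finset α).card :=
      Finset.card_le_card fun x _ => h x
    have := Finset.card_le_five (a := e) (b := a) (c := b) (d := c) (e := d)
    rw [Finset.card_univ] at *
    omega
  simp only [Finset.mem_insert, Finset.mem_singleton, not_or] at he hf
  have hef : e ≠ f := fun h => hf.1 h.symm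
  by_cases h1 : Module.finrank ℂ (LinearMap.ker (ρ (swap e f) + 1)) ≤ 1
  · exact hneg hef h1
  by_cases h2 : Module.finrank ℂ (LinearMap.ker (ρ (swap e f) - 1)) ≤ 1
  · exact hpos hef h2
  have hs := hsum e f
  let p : α → Prop := fun x => x ≠ e ∧ x ≠ f
  have hcomm : ∀ (g : Perm (Subtype p)) (x : V),
      ρ (swap e f) (ρ (Perm.ofSubtype g) x) = ρ (Perm.ofSubtype g) (ρ (swap e f) x) := by
    intro g x
    rw [← rep_mul_apply, ← rep_mul_apply, mul_swap_eq_swap_mul,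
      Perm.ofSubtype_apply_of_not_mem g (by simp [p]),
      Perm.ofSubtype_apply_of_not_mem g (by simp [p])]
  have hcard : Fintype.card (Subtype p) = N - 2 := by
    rw [Fintype.card_subtype]
    have : Finset.univ.filter p = ({e, f} : Finset α)ᶜ := by ext; simp [p]
    rw [this, Finset.card_compl, Finset.card_pair hef, hN]
  -- With both eigenspaces of `(e f)` of dimension at least `2`, each has dimension at most `dim V -
  -- 2 ≤ N - 4`. This is exactly the bound needed for the symmetric group on the `N - 2` letters
  -- other than `e` and `f`.
  have key : ∀ (E : Submodule ℂ V)
      (_ : ∀ (g : Perm (Subtype p)), ∀ v ∈ E, ρ (Perm.ofSubtype g) v ∈ E),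
      Module.finrank ℂ E + 2 ≤ N - 2 → ∀ x ∈ E, ρ (swap a b) x = ρ (swap c d) x := by
    intro E hE hEdim x hx
    have h3 := ih (N - 2) (by omega) (restrictSubtype ρ p E hE) hcard hEdim
      (a := ⟨a, Ne.symm he.1, Ne.symm hf.2.1⟩) (b := ⟨b, Ne.symm he.2.1, Ne.symm hf.2.2.1⟩)
      (c := ⟨c, Ne.symm he.2.2.1, Ne.symm hf.2.2.2.1⟩)
      (d := ⟨d, Ne.symm he.2.2.2, Ne.symm hf.2.2.2.2⟩)
      (by simpa using hab) (by simpa using hcd) (by simpa using hc) (by simpa using hd)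
    have h4 := congrArg Subtype.val (LinearMap.congr_fun h3 ⟨x, hx⟩)
    simpa [restrictSubtype, Perm.ofSubtype_swap_eq] using h4
  have hplus := key (LinearMap.ker (ρ (swap e f) + 1)) (fun g v hv => by
    rw [LinearMap.mem_ker, LinearMap.add_apply, Module.End.one_apply] at hv ⊢
    rw [hcomm, ← map_add, hv, map_zero]) (by omega)
  have hminus := key (LinearMap.ker (ρ (swap e f) - 1)) (fun g v hv => by
    rw [LinearMap.mem_ker, LinearMap.sub_apply, Module.End.one_apply] at hv ⊢
    rw [hcomm, ← map_sub, hv, map_zero]) (by omega)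
  ext x
  have hx : (2 : ℂ) • x = (x + ρ (swap e f) x) + (x - ρ (swap e f) x) := by module
  have h3 : (2 : ℂ) • ρ (swap a b) x = (2 : ℂ) • ρ (swap c d) x := by
    rw [← map_smul, ← map_smul, hx, map_add _ (x + _), map_add _ (x + _), hminus (x + _), hplus]
    · rw [LinearMap.mem_ker, LinearMap.add_apply, map_sub, rep_swap_swap, Module.End.one_apply]
      abel
    · rw [LinearMap.mem_ker, LinearMap.sub_apply, map_add, rep_swap_swap, Module.End.one_apply]
      abel
  exact smul_right_injective V two_ne_zero h3

/-- Two transpositions sharing a letter involve at most three letters, so for `card α ≥ 5` some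
transposition is disjoint from both. For four letters the conclusion fails in the two-dimensional
irreducible representation. -/
theorem rep_swap_eq_of_five_le [FiniteDimensional ℂ V] (h5 : 5 ≤ Fintype.card α)
    (hdim : Module.finrank ℂ V + 2 ≤ Fintype.card α) {a b c d : α} (hab : a ≠ b) (hcd : c ≠ d) :
    ρ (swap a b) = ρ (swap c d) := by
  by_cases h : (c ≠ a ∧ c ≠ b) ∧ (d ≠ a ∧ d ≠ b)
  · exact rep_swap_eq_of_finrank_le _ ρ rfl hdim hab hcd h.1 h.2
  have h3 : ({a, b, c, d} : Finset α).card ≤ 3 := by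
    by_cases hc : c ≠ a ∧ c ≠ b
    · have hd : d ∈ ({a, b, c} : Finset α) := by simp; tauto
      have : ({a, b, c, d} : Finset α) ⊆ {a, b, c} := by
        intro x hx; simp at hx hd ⊢; grind
      exact (Finset.card_le_card this).trans Finset.card_le_three
    · have : ({a, b, c, d} : Finset α) ⊆ {a, b, d} := by
        intro x hx; simp at hx ⊢; grind
      exact (Finset.card_le_card this).trans Finset.card_le_three
  have h2 : 1 < (({a, b, c, d} : Finset α)ᶜ).card := by rw [Finset.card_compl]; omega
  obtain ⟨e, he, f, hf, hef⟩ := Finset.one_lt_card.mp h2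
  simp only [Finset.mem_compl, Finset.mem_insert, Finset.mem_singleton, not_or] at he hf
  rw [rep_swap_eq_of_finrank_le _ ρ rfl hdim hab hef ⟨he.1, he.2.1⟩ ⟨hf.1, hf.2.1⟩,
    rep_swap_eq_of_finrank_le _ ρ rfl hdim hcd hef ⟨he.2.2.1, he.2.2.2⟩ ⟨hf.2.2.1, hf.2.2.2⟩]

end SmallDimension

/-- A subrepresentation of `(ℂ^d)^{⊗ n}`, `d < n`, of small dimension is a sum of trivial
representations. -/
theorem permRep_apply_eq_self {n d k : ℕ} (hk : k + 1 < n) (hk1 : 1 ≤ k) (hd : d < n)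
    (hn : ¬ (n = 4 ∧ k = 2)) (W : Subrepresentation (permRep n d))
    (hW : Module.finrank ℂ W.toSubmodule ≤ k) (σ : Equiv.Perm (Fin n)) {w : Config n d → ℂ}
    (hw : w ∈ W.toSubmodule) : permRep n d σ w = w := by
  have hswap : ∀ {a b c e : Fin n}, a ≠ b → c ≠ e →
      W.toRepresentation (Equiv.swap a b) = W.toRepresentation (Equiv.swap c e) := by
    intro a b c e hab hce
    by_cases hk' : k = 1
    · exact rep_swap_eq_of_finrank_le_one _ (hk' ▸ hW) hab hce
    · refine rep_swap_eq_of_five_le _ ?_ ?_ hab hce <;> rw [Fintype.card_fin] <;> omega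
  have hfix : ∀ {a b : Fin n}, a ≠ b → ∀ {w}, w ∈ W.toSubmodule →
      permRep n d (Equiv.swap a b) w = w := by
    intro a b hab w hw
    funext x
    -- By pigeonhole `x` repeats a letter. The transposition of two equal letters fixes `x`, and on
    -- `W` it acts as `(a b)` does.
    obtain ⟨i, j, hij, hxij⟩ := Fintype.exists_ne_map_eq_of_card_lt x (by simpa using hd)
    have h1 : permRep n d (Equiv.swap a b) w = permRep n d (Equiv.swap i j) w :=
      congrArg Subtype.val (LinearMap.congr_fun (hswap hab hij) ⟨w, hw⟩)
    rw [h1]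
    change w (x ∘ Equiv.swap i j) = w x
    congr 1
    funext l
    simp only [Function.comp_apply, Equiv.swap_apply_def]
    split_ifs with h2 h3
    · rw [h2, hxij]
    · rw [h3, hxij]
    · rfl
  induction σ using Equiv.Perm.swap_induction_on with
  | one => rw [map_one]; rfl
  | swap_mul f x y hxy ih => rw [map_mul, Module.End.mul_apply, ih, hfix hxy hw]

/-! ### Tensor powers -/

section TensorPower

variable {ι : Type*} (n : ℕ)

theorem tensorPower_mul [Fintype ι] (A B : Matrix ι ι ℂ) :
    tensorPower n (A * B) = tensorPower n A * tensorPower n B := by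
  ext x y
  simp only [tensorPower, Matrix.of_apply, Matrix.mul_apply, Finset.prod_univ_sum,
    Fintype.piFinset_univ, Finset.prod_mul_distrib]

theorem tensorPower_diagonal [DecidableEq ι] (t : ι → ℂ) :
    tensorPower n (Matrix.diagonal t) = Matrix.diagonal fun x => ∏ i, t (x i) := by
  ext x y
  simp only [tensorPower, Matrix.of_apply, Matrix.diagonal_apply]
  by_cases h : x = y
  · simp [h]
  · obtain ⟨i, hi⟩ := Function.ne_iff.mp h
    rw [if_neg h]
    exact Finset.prod_eq_zero (Finset.mem_univ i) (if_neg hi)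

theorem tensorPower_smul (c : ℂ) (A : Matrix ι ι ℂ) :
    tensorPower n (c • A) = c ^ n • tensorPower n A := by
  ext x y
  simp [tensorPower, Finset.prod_mul_distrib]

end TensorPower

/-! ### Words with equal letter counts -/

theorem exists_perm_of_card_fiber_eq {ι β : Type*} [Fintype ι] [DecidableEq β] (f g : ι → β)
    (h : ∀ b, (Finset.univ.filter fun i => f i = b).card =
      (Finset.univ.filter fun i => g i = b).card) :
    ∃ σ : Equiv.Perm ι, ∀ i, g (σ i) = f i := by
  have e : ∀ b, Nonempty ({i // f i = b} ≃ {i // g i = b}) := fun b =>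
    ⟨Fintype.equivOfCardEq (by rw [Fintype.card_subtype, Fintype.card_subtype, h])⟩
  let e b := Classical.choice (e b)
  refine ⟨((Equiv.sigmaFiberEquiv f).symm.trans (Equiv.sigmaCongrRight e)).trans
    (Equiv.sigmaFiberEquiv g), fun i => ?_⟩
  exact (e (f i) ⟨i, rfl⟩).2

theorem prod_update_one {ι β : Type*} [Fintype ι] [DecidableEq β] (f : ι → β) (b : β) (ω : ℂ) :
    ∏ i, (if f i = b then ω else 1) = ω ^ (Finset.univ.filter fun i => f i = b).card := by
  rw [Finset.prod_ite, Finset.prod_const, Finset.prod_const_one, mul_one]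

/-! ### Schur–Weyl duality -/

section SchurWeyl

variable {n d : ℕ}

/-- The matrix `T` commutes with the action of `S_n`. -/
def Equivariant (T : Matrix (Config n d) (Config n d) ℂ) : Prop :=
  ∀ (σ : Equiv.Perm (Fin n)) (x y : Config n d), T (x ∘ σ) (y ∘ σ) = T x y

theorem equivariant_tensorPower (A : Matrix (Fin d) (Fin d) ℂ) :
    Equivariant (tensorPower n A) := fun σ x y => by
  simp only [tensorPower, Matrix.of_apply, Function.comp_apply]
  exact Equiv.prod_comp σ fun i => A (x i) (y i)

variable {U : Matrix (Config n d) (Config n d) ℂ}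

/-- A unitary is a phase times an element of `SU(d)`, the phase being a `d`-th root of the
determinant; `d = 0` is separate because this root needs `d > 0`. -/
theorem commute_tensorPower_unitary
    (hU : ∀ g ∈ Matrix.specialUnitaryGroup (Fin d) ℂ, Commute U (tensorPower n g))
    {g : Matrix (Fin d) (Fin d) ℂ} (hg : g ∈ Matrix.unitaryGroup (Fin d) ℂ) :
    Commute U (tensorPower n g) := by
  rcases Nat.eq_zero_or_pos d with rfl | hd
  · exact hU g (Matrix.mem_specialUnitaryGroup_iff.mpr ⟨hg, Matrix.det_isEmpty⟩)
  obtain ⟨ζ, hζ⟩ := IsAlgClosed.exists_pow_nat_eq g.det hd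
  have hdet : ‖g.det‖ = 1 := CStarRing.norm_of_mem_unitary (Matrix.det_of_mem_unitary hg)
  have hζ1 : ‖ζ‖ = 1 := by
    rw [← hζ, norm_pow] at hdet
    exact (pow_eq_one_iff_of_nonneg (norm_nonneg _) hd.ne').mp hdet
  have hζ0 : ζ ≠ 0 := fun h => by simp [h] at hζ1
  have hsu : ζ⁻¹ • g ∈ Matrix.specialUnitaryGroup (Fin d) ℂ := by
    refine Matrix.mem_specialUnitaryGroup_iff.mpr ⟨?_, ?_⟩
    · rw [Matrix.mem_unitaryGroup_iff] at hg ⊢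
      rw [star_smul, smul_mul_smul_comm, hg]
      have : ζ⁻¹ * star ζ⁻¹ = 1 := by
        rw [← starRingEnd_apply, Complex.mul_conj, Complex.normSq_eq_norm_sq]
        simp [hζ1]
      rw [this, one_smul]
    · rw [Matrix.det_smul, Fintype.card_fin, ← hζ, ← mul_pow, inv_mul_cancel₀ hζ0, one_pow]
  have : g = ζ • (ζ⁻¹ • g) := by rw [smul_smul, mul_inv_cancel₀ hζ0, one_smul]
  rw [this, tensorPower_smul]
  exact (hU _ hsu).smul_right _

/-- Commuting with unitary diagonal matrices forces `U x y = 0` unless `x` and `y` are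
rearrangements of each other. For rearrangements `∏ t (x i) = ∏ t (y i)`, whatever `t` is. -/
theorem commute_tensorPower_diagonal
    (hU : ∀ g ∈ Matrix.unitaryGroup (Fin d) ℂ, Commute U (tensorPower n g)) (t : Fin d → ℂ) :
    Commute U (tensorPower n (Matrix.diagonal t)) := by
  have hentry : ∀ (t : Fin d → ℂ) x y, (U * tensorPower n (Matrix.diagonal t)) x y =
      U x y * ∏ i, t (y i) ∧ (tensorPower n (Matrix.diagonal t) * U) x y =
      (∏ i, t (x i)) * U x y := fun t x y => by
    rw [tensorPower_diagonal, Matrix.mul_diagonal, Matrix.diagonal_mul]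
    exact ⟨rfl, rfl⟩
  ext x y
  rw [(hentry t x y).1, (hentry t x y).2]
  by_cases h0 : U x y = 0
  · rw [h0, zero_mul, mul_zero]
  have hcount : ∀ a, (Finset.univ.filter fun i => x i = a).card =
      (Finset.univ.filter fun i => y i = a).card := by
    intro a
    -- Letter counts lie in `0, …, n`, so a root of unity of order `n + 1` separates them.
    have hω := Complex.isPrimitiveRoot_exp (n + 1) n.succ_ne_zero
    set ω := Complex.exp (2 * Real.pi * Complex.I / (n + 1 : ℕ))
    have hg : Matrix.diagonal (fun b => if b = a then ω else 1) ∈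
        Matrix.unitaryGroup (Fin d) ℂ := by
      rw [Matrix.mem_unitaryGroup_iff, Matrix.star_eq_conjTranspose,
        Matrix.diagonal_conjTranspose, Matrix.diagonal_mul_diagonal, ← Matrix.diagonal_one]
      congr 1
      funext b
      rw [Pi.star_apply]
      split_ifs
      · rw [← starRingEnd_apply, Complex.mul_conj, Complex.normSq_eq_norm_sq,
          hω.norm'_eq_one n.succ_ne_zero]
        simp
      · simp
    have h1 := congrFun (congrFun (hU _ hg).eq x) y
    rw [(hentry _ x y).1, (hentry _ x y).2, mul_comm] at h1
    have h2 := mul_right_cancel₀ h0 h1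
    rw [prod_update_one, prod_update_one] at h2
    have hle : ∀ z : Config n d, (Finset.univ.filter fun i => z i = a).card < n + 1 := fun z =>
      Nat.lt_succ_of_le ((Finset.card_le_univ _).trans (by simp))
    exact (hω.pow_inj (hle y) (hle x) h2).symm
  obtain ⟨σ, hσ⟩ := exists_perm_of_card_fiber_eq x y hcount
  rw [mul_comm, ← Equiv.prod_comp σ]
  simp only [hσ]

-- Singular value decomposition: `A = W D Vᴴ` with `W`, `V` unitary and `D` diagonal, obtained by
-- diagonalizing `Aᴴ A`.
open scoped ComplexOrder in
theorem commute_tensorPower_of_isUnit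
    (hU : ∀ g ∈ Matrix.unitaryGroup (Fin d) ℂ, Commute U (tensorPower n g))
    {A : Matrix (Fin d) (Fin d) ℂ} (hA : IsUnit A) : Commute U (tensorPower n A) := by
  have hpos : (A.conjTranspose * A).PosDef :=
    Matrix.PosDef.conjTranspose_mul_self A (Matrix.mulVec_injective_of_isUnit hA)
  have hH := hpos.isHermitian
  set V : Matrix (Fin d) (Fin d) ℂ := hH.eigenvectorUnitary.1 with hV
  have hVu : V ∈ Matrix.unitaryGroup (Fin d) ℂ := hH.eigenvectorUnitary.2
  have hVV : V * V.conjTranspose = 1 := Matrix.mem_unitaryGroup_iff.mp hVu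
  have hVV' : V.conjTranspose * V = 1 := Matrix.mem_unitaryGroup_iff'.mp hVu
  have hspec : V.conjTranspose * (A.conjTranspose * A) * V =
      Matrix.diagonal fun i => ((hH.eigenvalues i : ℝ) : ℂ) := by
    have := hH.conjStarAlgAut_star_eigenvectorUnitary
    rw [Unitary.conjStarAlgAut_star_apply] at this
    exact this
  set s : Fin d → ℂ := fun i => ((Real.sqrt (hH.eigenvalues i) : ℝ) : ℂ) with hs
  have hs0 : ∀ i, s i ≠ 0 := fun i =>
    Complex.ofReal_ne_zero.mpr (Real.sqrt_pos.mpr (hpos.eigenvalues_pos i)).ne'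
  set D := Matrix.diagonal s
  set D' := Matrix.diagonal fun i => (s i)⁻¹
  have hDD : D' * D = 1 := by
    rw [Matrix.diagonal_mul_diagonal, ← Matrix.diagonal_one]
    congr 1; funext i; exact inv_mul_cancel₀ (hs0 i)
  have hD'H : D'.conjTranspose = D' := by
    rw [Matrix.diagonal_conjTranspose]
    congr 1; funext i; simp [hs]
  have hW : A * V * D' ∈ Matrix.unitaryGroup (Fin d) ℂ := by
    rw [Matrix.mem_unitaryGroup_iff', Matrix.star_eq_conjTranspose, Matrix.conjTranspose_mul,
      Matrix.conjTranspose_mul, hD'H]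
    have : D' * (V.conjTranspose * A.conjTranspose) * (A * V * D') =
        D' * (V.conjTranspose * (A.conjTranspose * A) * V) * D' := by
      simp only [Matrix.mul_assoc]
    rw [this, hspec, Matrix.diagonal_mul_diagonal, Matrix.diagonal_mul_diagonal,
      ← Matrix.diagonal_one]
    congr 1; funext i
    have h1 : ((hH.eigenvalues i : ℝ) : ℂ) = s i * s i := by
      rw [hs, ← Complex.ofReal_mul, Real.mul_self_sqrt (hpos.eigenvalues_pos i).le]
    rw [h1]
    field_simp [hs0 i]
  have hAeq : A = (A * V * D') * D * V.conjTranspose := by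
    rw [Matrix.mul_assoc (A * V), hDD, Matrix.mul_one, Matrix.mul_assoc, hVV, Matrix.mul_one]
  rw [hAeq, tensorPower_mul, tensorPower_mul]
  refine ((hU _ hW).mul_right (commute_tensorPower_diagonal hU s)).mul_right (hU _ ?_)
  exact Unitary.star_mem hVu

/-- The exponent of the monomial `∏ i, X (y i, z i)`. -/
def wordExponent (y z : Config n d) : (Fin d × Fin d) →₀ ℕ :=
  ∑ i, Finsupp.single (y i, z i) 1

theorem prod_X_eq_monomial (y z : Config n d) :
    ∏ i, (MvPolynomial.X (y i, z i) : MvPolynomial (Fin d × Fin d) ℂ) =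
      MvPolynomial.monomial (wordExponent y z) 1 := by
  rw [wordExponent, MvPolynomial.monomial_sum_one]
  rfl

theorem Equivariant.apply_eq_of_wordExponent_eq {T : Matrix (Config n d) (Config n d) ℂ}
    (hT : Equivariant T) {y z y' z' : Config n d} (h : wordExponent y z = wordExponent y' z') :
    T y z = T y' z' := by
  have hcount : ∀ (y z : Config n d) (b : Fin d × Fin d),
      (Finset.univ.filter fun i => (y i, z i) = b).card = wordExponent y z b := by
    intro y z b
    rw [wordExponent, Finsupp.finsetSum_apply, Finset.card_filter]
    exact Finset.sum_congr rfl fun i _ => by rw [Finsupp.single_apply]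
  obtain ⟨σ, hσ⟩ := exists_perm_of_card_fiber_eq (fun i => (y i, z i)) (fun i => (y' i, z' i))
    fun b => by rw [hcount, hcount, h]
  rw [← hT σ y' z']
  congr 1
  · funext i; exact (congrArg Prod.fst (hσ i)).symm
  · funext i; exact (congrArg Prod.snd (hσ i)).symm

/-- Monomials of degree `n` in matrix entries are multisets of index pairs, that is, `S_n`-orbits of
pairs of words, and an equivariant `T` is constant on these orbits. -/
theorem Equivariant.exists_linearMap {T : Matrix (Config n d) (Config n d) ℂ}
    (hT : Equivariant T) : ∃ L : MvPolynomial (Fin d × Fin d) ℂ →ₗ[ℂ] ℂ,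
      ∀ y z : Config n d, L (∏ i, MvPolynomial.X (y i, z i)) = T y z := by
  classical
  refine ⟨(MvPolynomial.basisMonomials (Fin d × Fin d) ℂ).constr ℂ fun m =>
    if h : ∃ yz : Config n d × Config n d, wordExponent yz.1 yz.2 = m then
      T h.choose.1 h.choose.2 else 0, fun y z => ?_⟩
  have hb := (MvPolynomial.basisMonomials (Fin d × Fin d) ℂ).constr_basis ℂ (fun m =>
    if h : ∃ yz : Config n d × Config n d, wordExponent yz.1 yz.2 = m then
      T h.choose.1 h.choose.2 else 0) (wordExponent y z)
  rw [MvPolynomial.coe_basisMonomials] at hb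
  rw [prod_X_eq_monomial, hb]
  have h : ∃ yz : Config n d × Config n d, wordExponent yz.1 yz.2 = wordExponent y z :=
    ⟨(y, z), rfl⟩
  rw [dif_pos h]
  exact hT.apply_eq_of_wordExponent_eq h.choose_spec

/-- Schur–Weyl duality: a matrix which commutes with `g^{⊗ n}` for all `g ∈ SU(d)` commutes with
all matrices which commute with the action of `S_n`. -/
theorem Equivariant.commute
    (hU : ∀ g ∈ Matrix.specialUnitaryGroup (Fin d) ℂ, Commute U (tensorPower n g))
    {T : Matrix (Config n d) (Config n d) ℂ} (hT : Equivariant T) : Commute U T := by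
  obtain ⟨L, hL⟩ := hT.exists_linearMap
  ext x z
  -- The entries of `U A^{⊗n} = A^{⊗n} U` are polynomial identities in `A` valid on `GL_d`, hence
  -- formal ones. The functional `L` then replaces `A^{⊗n}` by `T`.
  have hpoly : ∑ y, U x y • ∏ i, (MvPolynomial.X (y i, z i) : MvPolynomial (Fin d × Fin d) ℂ) =
      ∑ y, U y z • ∏ i, (MvPolynomial.X (x i, y i) : MvPolynomial (Fin d × Fin d) ℂ) := by
    refine MvPolynomial.eq_of_eval_eq_on_gl fun g => ?_
    have h1 := commute_tensorPower_of_isUnit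
      (fun g hg => commute_tensorPower_unitary hU hg) g.isUnit
    have h2 := congrFun (congrFun h1.eq x) z
    simp only [Matrix.mul_apply, tensorPower, Matrix.of_apply] at h2
    simp only [map_sum, MvPolynomial.smul_eval, map_prod, MvPolynomial.eval_X]
    rw [h2]
    exact Finset.sum_congr rfl fun y _ => mul_comm _ _
  have h3 := congrArg L hpoly
  simp only [map_sum, map_smul, hL, smul_eq_mul] at h3
  rw [Matrix.mul_apply, Matrix.mul_apply, h3]
  exact Finset.sum_congr rfl fun y _ => mul_comm _ _

theorem mem_symmetricUnitaries_iff {U : Matrix.unitaryGroup (Config n d) ℂ} :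
    U ∈ symmetricUnitaries n d ↔ ∀ T : Matrix (Config n d) (Config n d) ℂ, Equivariant T →
      Commute (U : Matrix (Config n d) (Config n d) ℂ) T :=
  ⟨fun h _ hT => hT.commute h, fun h g _ => h _ (equivariant_tensorPower g)⟩

end SchurWeyl

/-! ### Orthogonal projections as matrices -/

section OrthProj

variable {ι : Type*} [Fintype ι] [DecidableEq ι]

theorem exists_orthProj (W : Submodule ℂ (ι → ℂ)) : ∃ P : Matrix ι ι ℂ,
    P.IsHermitian ∧ (∀ v, P.mulVec v ∈ W) ∧ ∀ v ∈ W, P.mulVec v = v := by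
  let K : Submodule ℂ (EuclideanSpace ℂ ι) :=
    W.comap (WithLp.linearEquiv 2 ℂ (ι → ℂ)).toLinearMap
  let L : EuclideanSpace ℂ ι →ₗ[ℂ] EuclideanSpace ℂ ι := K.starProjection.toLinearMap
  let P : Matrix ι ι ℂ := Matrix.toEuclideanLin.symm L
  have hP : Matrix.toEuclideanLin P = L := LinearEquiv.apply_symm_apply _ _
  have hmul : ∀ v : ι → ℂ, P.mulVec v = (L (WithLp.toLp 2 v)).ofLp := fun v => by
    rw [← hP]; rfl
  refine ⟨P, ?_, fun v => ?_, fun v hv => ?_⟩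
  · rw [← Matrix.isSymmetric_toEuclideanLin_iff, hP]
    exact K.starProjection_isSymmetric
  · rw [hmul]
    exact K.starProjection_apply_mem (WithLp.toLp 2 v)
  · rw [hmul]
    have hK : WithLp.toLp 2 v ∈ K := hv
    exact congrArg WithLp.ofLp (Submodule.starProjection_eq_self_iff.mpr hK)

/-- The matrix of the orthogonal projection onto the subspace `W` of `ℂ^ι`. -/
def orthProj (W : Submodule ℂ (ι → ℂ)) : Matrix ι ι ℂ := (exists_orthProj W).choose

theorem orthProj_isHermitian (W : Submodule ℂ (ι → ℂ)) : (orthProj W).IsHermitian :=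
  (exists_orthProj W).choose_spec.1

theorem orthProj_mulVec_mem (W : Submodule ℂ (ι → ℂ)) (v : ι → ℂ) :
    (orthProj W).mulVec v ∈ W := (exists_orthProj W).choose_spec.2.1 v

theorem orthProj_mulVec_of_mem {W : Submodule ℂ (ι → ℂ)} {v : ι → ℂ} (hv : v ∈ W) :
    (orthProj W).mulVec v = v := (exists_orthProj W).choose_spec.2.2 v hv

theorem orthProj_mul_mul {W : Submodule ℂ (ι → ℂ)} {M : Matrix ι ι ℂ}
    (hM : ∀ v ∈ W, M.mulVec v ∈ W) : orthProj W * (M * orthProj W) = M * orthProj W := by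
  refine Matrix.mulVec_injective (funext fun v => ?_)
  rw [← Matrix.mulVec_mulVec, ← Matrix.mulVec_mulVec]
  exact orthProj_mulVec_of_mem (hM _ (orthProj_mulVec_mem W v))

/-- Stability under `M` gives `PMP = MP`; stability under the adjoint gives, after taking adjoints,
`PMP = PM`. -/
theorem commute_orthProj {W : Submodule ℂ (ι → ℂ)} {M : Matrix ι ι ℂ}
    (hM : ∀ v ∈ W, M.mulVec v ∈ W) (hM' : ∀ v ∈ W, M.conjTranspose.mulVec v ∈ W) :
    Commute (orthProj W) M := by
  have h1 := orthProj_mul_mul hM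
  have h2 := congrArg Matrix.conjTranspose (orthProj_mul_mul hM')
  simp only [Matrix.conjTranspose_mul, Matrix.conjTranspose_conjTranspose,
    (orthProj_isHermitian W).eq] at h2
  rw [Matrix.mul_assoc] at h2
  exact h2.symm.trans h1

end OrthProj

/-! ### Irreducible subspaces of `(ℂ^d)^{⊗ n}` -/

section Irreducible

variable {n d : ℕ}

theorem permRep_apply (σ : Equiv.Perm (Fin n)) (v : Config n d → ℂ) (x : Config n d) :
    permRep n d σ v x = v (x ∘ σ) := rfl

theorem permRep_single (σ : Equiv.Perm (Fin n)) (y : Config n d) :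
    permRep n d σ (Pi.single (y ∘ σ) 1) = Pi.single y 1 := by
  funext x
  rw [permRep_apply, Pi.single_apply, Pi.single_apply]
  have : x ∘ σ = y ∘ σ ↔ x = y := σ.surjective.injective_comp_right.eq_iff
  simp only [this]

theorem Equivariant.mulVec_permRep {T : Matrix (Config n d) (Config n d) ℂ} (hT : Equivariant T)
    (σ : Equiv.Perm (Fin n)) (v : Config n d → ℂ) :
    T.mulVec (permRep n d σ v) = permRep n d σ (T.mulVec v) := by
  funext x
  rw [permRep_apply]
  simp only [Matrix.mulVec, dotProduct, permRep_apply]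
  let e : Config n d ≃ Config n d := Equiv.arrowCongr σ.symm (Equiv.refl (Fin d))
  refine (Finset.sum_congr rfl fun y _ => ?_).trans
    (Equiv.sum_comp e fun y => T (x ∘ σ) y * v y)
  exact congrArg (· * v (y ∘ σ)) (hT σ x y).symm

theorem equivariant_of_mulVec_permRep {T : Matrix (Config n d) (Config n d) ℂ}
    (h : ∀ σ v, T.mulVec (permRep n d σ v) = permRep n d σ (T.mulVec v)) : Equivariant T := by
  intro σ x y
  have := congrFun (h σ (Pi.single (y ∘ σ) 1)) x
  rw [permRep_single, permRep_apply, Matrix.mulVec_single_one, Matrix.mulVec_single_one] at this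
  exact this.symm

theorem Equivariant.mul {S T : Matrix (Config n d) (Config n d) ℂ} (hS : Equivariant S)
    (hT : Equivariant T) : Equivariant (S * T) :=
  equivariant_of_mulVec_permRep fun σ v => by
    rw [← Matrix.mulVec_mulVec, ← Matrix.mulVec_mulVec, hT.mulVec_permRep, hS.mulVec_permRep]

theorem Equivariant.conjTranspose {T : Matrix (Config n d) (Config n d) ℂ} (hT : Equivariant T) :
    Equivariant T.conjTranspose := fun σ x y => by
  rw [Matrix.conjTranspose_apply, Matrix.conjTranspose_apply, hT]

theorem Equivariant.smul {T : Matrix (Config n d) (Config n d) ℂ} (c : ℂ) (hT : Equivariant T) :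
    Equivariant (c • T) := fun σ x y => by
  rw [Matrix.smul_apply, Matrix.smul_apply, hT]

theorem equivariant_one : Equivariant (1 : Matrix (Config n d) (Config n d) ℂ) :=
  equivariant_of_mulVec_permRep fun σ v => by rw [Matrix.one_mulVec, Matrix.one_mulVec]

/-- The subspace `W` is stable under the action of `S_n`. -/
def IsStable (W : Submodule ℂ (Config n d → ℂ)) : Prop :=
  ∀ (σ : Equiv.Perm (Fin n)), ∀ v ∈ W, permRep n d σ v ∈ W

/-- Permutations act by unitary matrices, so a stable subspace is also stable under the adjoints. -/
theorem IsStable.equivariant_orthProj {W : Submodule ℂ (Config n d → ℂ)} (hW : IsStable W) :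
    Equivariant (orthProj W) := by
  refine equivariant_of_mulVec_permRep fun σ v => ?_
  let M : Equiv.Perm (Fin n) → Matrix (Config n d) (Config n d) ℂ :=
    fun σ => LinearMap.toMatrix' (permRep n d σ)
  have hM : ∀ σ v, (M σ).mulVec v = permRep n d σ v := fun σ v =>
    LinearMap.toMatrix'_mulVec (permRep n d σ) v
  have hstar : (M σ).conjTranspose = M σ⁻¹ := by
    ext x y
    simp only [M, Matrix.conjTranspose_apply, LinearMap.toMatrix'_apply, permRep_apply,
      Pi.single_apply]
    have : y ∘ σ = x ↔ x ∘ (σ⁻¹ : Equiv.Perm (Fin n)) = y := by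
      constructor
      · rintro rfl; funext i; simp
      · rintro rfl; funext i; simp
    simp only [this]
    split_ifs <;> simp
  have hc := commute_orthProj (W := W) (M := M σ) (fun v hv => by rw [hM]; exact hW σ v hv)
    (fun v hv => by rw [hstar, hM]; exact hW σ⁻¹ v hv)
  rw [← hM, Matrix.mulVec_mulVec, hc.eq, ← Matrix.mulVec_mulVec, hM]

/-- The subspace `W` is an irreducible subrepresentation of `(ℂ^d)^{⊗ n}`. -/
structure IsIrred (W : Submodule ℂ (Config n d → ℂ)) : Prop where
  stable : IsStable W
  ne_bot : W ≠ ⊥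
  eq_of_le : ∀ X : Submodule ℂ (Config n d → ℂ), IsStable X → X ≤ W → X ≠ ⊥ → X = W

theorem isIrred_of_isIrreducible (W : Subrepresentation (permRep n d))
    (hW : W.toRepresentation.IsIrreducible) : IsIrred W.toSubmodule := by
  refine ⟨W.apply_mem_toSubmodule, fun h => ?_, fun X hX hle hne => ?_⟩
  · refine bot_ne_top (α := Subrepresentation W.toRepresentation) ?_
    refine Subrepresentation.toSubmodule_injective ?_
    change (⊥ : Submodule ℂ W.toSubmodule) = ⊤
    have : Subsingleton W.toSubmodule := by rw [h]; infer_instance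
    exact Subsingleton.elim _ _
  · let Y : Subrepresentation W.toRepresentation :=
      ⟨X.comap W.toSubmodule.subtype, fun g v hv => hX g v hv⟩
    rcases eq_bot_or_eq_top Y with h | h
    · exfalso
      have h1 : X.comap W.toSubmodule.subtype = ⊥ :=
        congrArg Subrepresentation.toSubmodule h
      refine hne ((Submodule.eq_bot_iff _).mpr fun x hx => ?_)
      have : (⟨x, hle hx⟩ : W.toSubmodule) ∈ X.comap W.toSubmodule.subtype := hx
      rw [h1, Submodule.mem_bot] at this
      exact congrArg Subtype.val this
    · have h1 : X.comap W.toSubmodule.subtype = ⊤ :=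
        congrArg Subrepresentation.toSubmodule h
      refine le_antisymm hle fun x hx => ?_
      have : (⟨x, hx⟩ : W.toSubmodule) ∈ X.comap W.toSubmodule.subtype := by rw [h1]; trivial
      exact this

theorem exists_isIrred_le {X : Submodule ℂ (Config n d → ℂ)} (hX : IsStable X) (hne : X ≠ ⊥) :
    ∃ W ≤ X, IsIrred W := by
  obtain ⟨W, ⟨hW1, hW2, hW3⟩, hmin⟩ := WellFounded.has_min
    (wellFounded_lt (α := Submodule ℂ (Config n d → ℂ)))
    {W | W ≤ X ∧ IsStable W ∧ W ≠ ⊥} ⟨X, le_rfl, hX, hne⟩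
  refine ⟨W, hW1, hW2, hW3, fun Y hY hle hYne => ?_⟩
  by_contra h
  exact hmin Y ⟨hle.trans hW1, hY, hYne⟩ (lt_of_le_of_ne hle h)

/-- Complete reducibility: the kernel of the projection onto the sum `Y` of all irreducible
subspaces is stable. If nonzero, it contains an irreducible subspace, which also lies in `Y` and is
therefore fixed by the projection. -/
theorem sSup_isIrred : sSup {W : Submodule ℂ (Config n d → ℂ) | IsIrred W} = ⊤ := by
  set Y := sSup {W : Submodule ℂ (Config n d → ℂ) | IsIrred W} with hY
  have hYs : IsStable Y := by
    intro σ
    change Y ≤ Y.comap (permRep n d σ)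
    refine sSup_le fun W hW v hv => ?_
    exact (le_sSup hW : W ≤ Y) (hW.stable σ v hv)
  have hker : LinearMap.ker (orthProj Y).mulVecLin = ⊥ := by
    by_contra hne
    obtain ⟨W, hWle, hW⟩ := exists_isIrred_le (X := LinearMap.ker (orthProj Y).mulVecLin)
      (fun σ v hv => by
        rw [LinearMap.mem_ker, Matrix.mulVecLin_apply] at hv ⊢
        rw [hYs.equivariant_orthProj.mulVec_permRep, hv, map_zero]) hne
    refine hW.ne_bot ((Submodule.eq_bot_iff _).mpr fun w hw => ?_)
    rw [← orthProj_mulVec_of_mem ((le_sSup hW : W ≤ Y) hw)]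
    exact hWle hw
  refine (Submodule.eq_top_iff').mpr fun v => ?_
  have hv : v - (orthProj Y).mulVec v ∈ LinearMap.ker (orthProj Y).mulVecLin := by
    rw [LinearMap.mem_ker, Matrix.mulVecLin_apply, Matrix.mulVec_sub,
      orthProj_mulVec_of_mem (orthProj_mulVec_mem Y v), sub_self]
  rw [hker, Submodule.mem_bot, sub_eq_zero] at hv
  rw [hv]
  exact orthProj_mulVec_mem Y v

/-- Matrices which agree on all irreducible subspaces are equal. -/
theorem eq_of_mulVec_eq_on_isIrred {S T : Matrix (Config n d) (Config n d) ℂ}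
    (h : ∀ W, IsIrred W → ∀ w ∈ W, S.mulVec w = T.mulVec w) : S = T := by
  refine Matrix.mulVec_injective (funext fun v => ?_)
  have hle : (⊤ : Submodule ℂ (Config n d → ℂ)) ≤ LinearMap.eqLocus S.mulVecLin T.mulVecLin := by
    rw [← sSup_isIrred]
    exact sSup_le fun W hW w hw => h W hW w hw
  exact hle (Submodule.mem_top (x := v))

variable {W W' : Submodule ℂ (Config n d → ℂ)} {T : Matrix (Config n d) (Config n d) ℂ}

theorem IsIrred.mulVec_eq_zero_or (hW : IsIrred W) (hT : Equivariant T) :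
    (∀ w ∈ W, T.mulVec w = 0) ∨ ∀ w ∈ W, T.mulVec w = 0 → w = 0 := by
  let X := W ⊓ LinearMap.ker T.mulVecLin
  have hX : IsStable X := fun σ v hv => by
    refine ⟨hW.stable σ v hv.1, ?_⟩
    have h := hv.2
    rw [SetLike.mem_coe, LinearMap.mem_ker, Matrix.mulVecLin_apply] at h ⊢
    rw [hT.mulVec_permRep, h, map_zero]
  by_cases h : X = ⊥
  · right
    intro w hw h0
    exact (Submodule.eq_bot_iff _).mp h w ⟨hw, h0⟩
  · left
    have := hW.eq_of_le X hX inf_le_left h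
    intro w hw
    rw [← this] at hw
    exact hw.2

theorem IsIrred.exists_mem_ne_zero (hW : IsIrred W) : ∃ w ∈ W, w ≠ 0 :=
  W.exists_mem_ne_zero_of_ne_bot hW.ne_bot

/-- Schur lemma. -/
theorem IsIrred.exists_eq_smul (hW : IsIrred W) (hT : Equivariant T)
    (hTW : ∀ w ∈ W, T.mulVec w ∈ W) : ∃ c : ℂ, ∀ w ∈ W, T.mulVec w = c • w := by
  have : Nontrivial W := Submodule.nontrivial_iff_ne_bot.mpr hW.ne_bot
  obtain ⟨c, hc⟩ := Module.End.exists_eigenvalue (T.mulVecLin.restrict hTW)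
  obtain ⟨v, hv, hv0⟩ := hc.exists_hasEigenvector
  rw [Module.End.mem_eigenspace_iff] at hv
  have hv' : T.mulVec v = c • (v : Config n d → ℂ) := congrArg Subtype.val hv
  refine ⟨c, ?_⟩
  have hS : Equivariant (T - c • 1) := fun σ x y => by
    rw [Matrix.sub_apply, Matrix.sub_apply, hT, equivariant_one.smul c σ x y]
  have hmul : ∀ w, (T - c • 1).mulVec w = T.mulVec w - c • w := fun w => by
    rw [Matrix.sub_mulVec, Matrix.smul_mulVec, Matrix.one_mulVec]
  rcases hW.mulVec_eq_zero_or hS with h | h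
  · intro w hw
    have := h w hw
    rwa [hmul, sub_eq_zero] at this
  · exact absurd (Subtype.ext (h v v.2 (by rw [hmul, hv', sub_self]))) hv0

/-- The orthogonal projection onto `W` is itself equivariant, so `T` commutes with it. -/
theorem IsStable.mulVec_mem_of_commute (hW : IsStable W)
    (hT : ∀ S : Matrix (Config n d) (Config n d) ℂ, Equivariant S → Commute T S) {w} (hw : w ∈ W) :
    T.mulVec w ∈ W := by
  have h := (hT _ hW.equivariant_orthProj).eq
  rw [← orthProj_mulVec_of_mem hw, Matrix.mulVec_mulVec, h, ← Matrix.mulVec_mulVec]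
  exact orthProj_mulVec_mem W _

/-! ### Isotypic projections -/

/-- The smallest subspace which contains `W` and is stable under all matrices commuting with
the action of `S_n`. -/
def isotypicHull (W : Submodule ℂ (Config n d → ℂ)) : Submodule ℂ (Config n d → ℂ) :=
  Submodule.span ℂ {v | ∃ S : Matrix (Config n d) (Config n d) ℂ, Equivariant S ∧
    ∃ w ∈ W, S.mulVec w = v}

theorem mulVec_mem_isotypicHull (hT : Equivariant T) {v} (hv : v ∈ isotypicHull W) :
    T.mulVec v ∈ isotypicHull W := by
  have : isotypicHull W ≤ (isotypicHull W).comap T.mulVecLin := by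
    refine Submodule.span_le.mpr ?_
    rintro _ ⟨S, hS, w, hw, rfl⟩
    refine Submodule.subset_span ⟨T * S, hT.mul hS, w, hw, ?_⟩
    rw [Matrix.mulVecLin_apply, Matrix.mulVec_mulVec]
  exact this hv

theorem le_isotypicHull : W ≤ isotypicHull W := fun w hw =>
  Submodule.subset_span ⟨1, equivariant_one, w, hw, Matrix.one_mulVec w⟩

theorem isotypicHull_le {X : Submodule ℂ (Config n d → ℂ)} (hWX : W ≤ X)
    (hX : ∀ S : Matrix (Config n d) (Config n d) ℂ, Equivariant S → ∀ v ∈ X, S.mulVec v ∈ X) :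
    isotypicHull W ≤ X := by
  refine Submodule.span_le.mpr ?_
  rintro _ ⟨S, hS, w, hw, rfl⟩
  exact hX S hS w (hWX hw)

theorem IsStable.isotypicHull (hW : IsStable W) : IsStable (isotypicHull W) := by
  intro σ
  change SymDesign.isotypicHull W ≤ (SymDesign.isotypicHull W).comap (permRep n d σ)
  refine Submodule.span_le.mpr ?_
  rintro _ ⟨S, hS, w, hw, rfl⟩
  exact Submodule.subset_span ⟨S, hS, permRep n d σ w, hW σ w hw, hS.mulVec_permRep σ w⟩

/-- The projection onto the isotypic component of the irreducible subspace `W`. -/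
def isotypicProj (W : Submodule ℂ (Config n d → ℂ)) : Matrix (Config n d) (Config n d) ℂ :=
  orthProj (isotypicHull W)

theorem commute_isotypicProj (hT : Equivariant T) : Commute (isotypicProj W) T :=
  commute_orthProj (fun _ hv => mulVec_mem_isotypicHull hT hv)
    (fun _ hv => mulVec_mem_isotypicHull hT.conjTranspose hv)

theorem IsIrred.equivariant_isotypicProj (hW : IsIrred W) : Equivariant (isotypicProj W) :=
  hW.stable.isotypicHull.equivariant_orthProj

theorem isotypicProj_mulVec_of_mem {w} (hw : w ∈ W) : (isotypicProj W).mulVec w = w :=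
  orthProj_mulVec_of_mem (le_isotypicHull hw)

/-- The projection is central in the commutant, so it is a scalar on `W'` by Schur's lemma, and an
idempotent scalar is `0` or `1`. -/
theorem IsIrred.isotypicProj_mulVec_eq_or (hW : IsIrred W) (hW' : IsIrred W') :
    (∀ w ∈ W', (isotypicProj W).mulVec w = w) ∨ ∀ w ∈ W', (isotypicProj W).mulVec w = 0 := by
  obtain ⟨c, hc⟩ := hW'.exists_eq_smul hW.equivariant_isotypicProj fun w hw =>
    hW'.stable.mulVec_mem_of_commute (fun S hS => commute_isotypicProj hS) hw
  obtain ⟨w, hw, hw0⟩ := hW'.exists_mem_ne_zero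
  have h1 : (isotypicProj W).mulVec ((isotypicProj W).mulVec w) = (isotypicProj W).mulVec w :=
    orthProj_mulVec_of_mem (orthProj_mulVec_mem _ _)
  rw [hc w hw, Matrix.mulVec_smul, hc w hw, smul_smul] at h1
  have h2 : (c * c - c) • w = 0 := by rw [sub_smul, h1, sub_self]
  have h3 := (smul_eq_zero.mp h2).resolve_right hw0
  have h4 : c * (c - 1) = 0 := by linear_combination h3
  rcases mul_eq_zero.mp h4 with h | h
  · right; intro w hw; rw [hc w hw, h, zero_smul]
  · left; intro w hw; rw [hc w hw, sub_eq_zero.mp h, one_smul]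

/-- There is a nonzero equivariant map between the two subspaces. -/
def Related (W W' : Submodule ℂ (Config n d → ℂ)) : Prop :=
  ∃ S : Matrix (Config n d) (Config n d) ℂ, Equivariant S ∧ (∀ w ∈ W, S.mulVec w ∈ W') ∧
    ∃ w ∈ W, S.mulVec w ≠ 0

/-- If no equivariant image of `W` had a component in `W'`, the isotypic component of `W` would be
orthogonal to `W'`. -/
theorem IsIrred.related_of_isotypicProj (hW' : IsIrred W')
    (h : ∀ w ∈ W', (isotypicProj W).mulVec w = w) : Related W W' := by
  by_contra hrel
  have hP := hW'.stable.equivariant_orthProj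
  have h0 : isotypicHull W ≤ LinearMap.ker (orthProj W').mulVecLin := by
    refine Submodule.span_le.mpr ?_
    rintro _ ⟨S, hS, w, hw, rfl⟩
    by_contra hne
    refine hrel ⟨orthProj W' * S, hP.mul hS, fun v _ => ?_, w, hw, ?_⟩
    · rw [← Matrix.mulVec_mulVec]; exact orthProj_mulVec_mem _ _
    · rw [← Matrix.mulVec_mulVec]; exact hne
  obtain ⟨w, hw, hw0⟩ := hW'.exists_mem_ne_zero
  apply hw0
  rw [← orthProj_mulVec_of_mem hw]
  refine h0 ?_
  rw [← h w hw]
  exact orthProj_mulVec_mem _ _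

theorem IsIrred.exists_equiv_of_related (hW : IsIrred W) (hW' : IsIrred W') (h : Related W W') :
    ∃ (S : Matrix (Config n d) (Config n d) ℂ) (e : W ≃ₗ[ℂ] W'), Equivariant S ∧
      ∀ w : W, (e w : Config n d → ℂ) = S.mulVec w := by
  obtain ⟨S, hS, hmap, w₀, hw₀, hne⟩ := h
  have hinj := (hW.mulVec_eq_zero_or hS).resolve_left fun h => hne (h w₀ hw₀)
  have hrange : W.map S.mulVecLin = W' := by
    refine hW'.eq_of_le _ ?_ ?_ ?_
    · rintro σ _ ⟨w, hw, rfl⟩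
      exact ⟨permRep n d σ w, hW.stable σ w hw, hS.mulVec_permRep σ w⟩
    · rintro _ ⟨w, hw, rfl⟩
      exact hmap w hw
    · intro hbot
      have : S.mulVec w₀ ∈ W.map S.mulVecLin := ⟨w₀, hw₀, rfl⟩
      rw [hbot] at this
      exact hne this
  refine ⟨S, LinearEquiv.ofBijective (S.mulVecLin.restrict hmap) ⟨?_, ?_⟩, hS, fun w => rfl⟩
  · rw [injective_iff_map_eq_zero]
    intro w hw
    exact Subtype.ext (hinj w w.2 (congrArg Subtype.val hw))
  · rintro ⟨w', hw'⟩
    rw [← hrange] at hw'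
    obtain ⟨w, hw, rfl⟩ := hw'
    exact ⟨⟨w, hw⟩, rfl⟩

theorem IsIrred.isotypicProj_eq_of_related (hW : IsIrred W) (hW' : IsIrred W')
    (h : Related W W') : isotypicProj W = isotypicProj W' := by
  obtain ⟨S, e, hS, he⟩ := hW.exists_equiv_of_related hW' h
  refine congrArg orthProj (le_antisymm ?_ ?_)
  · refine isotypicHull_le (fun w hw => ?_) fun S hS v hv => mulVec_mem_isotypicHull hS hv
    rcases hW'.isotypicProj_mulVec_eq_or hW with h1 | h1
    · rw [← h1 w hw]; exact orthProj_mulVec_mem _ _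
    · exfalso
      obtain ⟨v, hv, hv0⟩ := hW.exists_mem_ne_zero
      have h2 : S.mulVec v = 0 := by
        have h3 : S.mulVec v ∈ W' := he ⟨v, hv⟩ ▸ (e ⟨v, hv⟩).2
        rw [← isotypicProj_mulVec_of_mem h3, Matrix.mulVec_mulVec, (commute_isotypicProj hS).eq,
          ← Matrix.mulVec_mulVec, h1 v hv, Matrix.mulVec_zero]
      rw [← he ⟨v, hv⟩] at h2
      have h4 : e ⟨v, hv⟩ = 0 := Subtype.ext h2
      exact hv0 (congrArg Subtype.val (e.map_eq_zero_iff.mp h4))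
  · refine isotypicHull_le (fun w hw => ?_) fun S hS v hv => mulVec_mem_isotypicHull hS hv
    have h1 : w = S.mulVec (e.symm ⟨w, hw⟩) := by rw [← he, e.apply_symm_apply]
    rw [h1]
    exact mulVec_mem_isotypicHull hS (le_isotypicHull (e.symm ⟨w, hw⟩).2)

theorem IsIrred.related_of_isotypicProj_eq (hW' : IsIrred W')
    (h : isotypicProj W = isotypicProj W') : Related W W' :=
  hW'.related_of_isotypicProj fun _ hw => h ▸ isotypicProj_mulVec_of_mem hw

/-- The matrix `isotypicProj W` thus serves as a label for the isomorphism class of `W`; phases are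
indexed by these labels. -/
theorem IsIrred.isotypicProj_mulVec (hW : IsIrred W) (hW' : IsIrred W') {w} (hw : w ∈ W') :
    ((isotypicProj W).mulVec w = w ∧ isotypicProj W = isotypicProj W') ∨
      ((isotypicProj W).mulVec w = 0 ∧ isotypicProj W ≠ isotypicProj W') := by
  by_cases h : isotypicProj W = isotypicProj W'
  · exact Or.inl ⟨h ▸ isotypicProj_mulVec_of_mem hw, h⟩
  · refine Or.inr ⟨?_, h⟩
    rcases hW.isotypicProj_mulVec_eq_or hW' with h1 | h1
    · exact absurd (hW.isotypicProj_eq_of_related hW' (hW'.related_of_isotypicProj h1)) h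
    · exact h1 w hw

end Irreducible

/-! ### Relative phases -/

/-! ### Determinants of unitaries on invariant subspaces -/

section NormDet

variable {ι : Type*} [Fintype ι] [DecidableEq ι]

open scoped Matrix.Norms.L2Operator in
theorem norm_eq_one_of_mulVec_eq_smul {U : Matrix ι ι ℂ} (hU : U ∈ Matrix.unitaryGroup ι ℂ)
    {c : ℂ} {v : ι → ℂ} (hv : v ≠ 0) (h : U.mulVec v = c • v) : ‖c‖ = 1 := by
  have h1 : Module.End.HasEigenvalue (Matrix.toLin' U) c :=
    Module.End.hasEigenvalue_of_hasEigenvector (x := v)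
      ⟨Module.End.mem_eigenspace_iff.mpr (by rw [Matrix.toLin'_apply, h]), hv⟩
  have h2 := h1.mem_spectrum
  rw [Matrix.spectrum_toLin'] at h2
  simpa using spectrum.subset_circle_of_unitary hU h2

/-- The determinant is the product of the eigenvalues of the restriction, which are eigenvalues of
`U` and so have modulus one. -/
theorem norm_det_restrict_eq_one {U : Matrix ι ι ℂ} (hU : U ∈ Matrix.unitaryGroup ι ℂ)
    {W : Submodule ℂ (ι → ℂ)} (hW : ∀ v ∈ W, Matrix.toLin' U v ∈ W) :
    ‖LinearMap.det ((Matrix.toLin' U).restrict hW)‖ = 1 := by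
  set f := (Matrix.toLin' U).restrict hW with hf
  let b := Module.finBasis ℂ W
  rw [← LinearMap.det_toMatrix b, Matrix.det_eq_prod_roots_charpoly, LinearMap.charpoly_toMatrix,
    ← coe_nnnorm, ← NNReal.coe_one, NNReal.coe_inj]
  have : (‖f.charpoly.roots.prod‖₊ : NNReal) = (f.charpoly.roots.map fun c => ‖c‖₊).prod :=
    map_multiset_prod (nnnormHom : ℂ →*₀ NNReal) _
  rw [this]
  refine Multiset.prod_eq_one fun x hx => ?_
  obtain ⟨c, hc, rfl⟩ := Multiset.mem_map.mp hx
  have hev := (Module.End.hasEigenvalue_iff_isRoot_charpoly f c).mpr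
    (Polynomial.isRoot_of_mem_roots hc)
  obtain ⟨v, hv, hv0⟩ := hev.exists_hasEigenvector
  rw [Module.End.mem_eigenspace_iff] at hv
  have h := norm_eq_one_of_mulVec_eq_smul hU (c := c) (v := (v : ι → ℂ))
    (fun h => hv0 (Subtype.ext h)) (congrArg Subtype.val hv)
  exact NNReal.coe_injective h

end NormDet

/-! ### Phases on isotypic components -/

section Phases

variable {n d : ℕ}

/-- Reindexing by `Config n d` makes the change of basis a square matrix. Orthogonality of the basis
is not needed. -/
theorem exists_basis_isIrred (n d : ℕ) :
    ∃ (b : Module.Basis (Config n d) ℂ (Config n d → ℂ))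
      (W : Config n d → Submodule ℂ (Config n d → ℂ)), ∀ i, IsIrred (W i) ∧ b i ∈ W i := by
  let s : Set (Config n d → ℂ) := {v | ∃ W, IsIrred W ∧ v ∈ W}
  have hs : Submodule.span ℂ s = ⊤ := by
    rw [eq_top_iff, ← sSup_isIrred]
    exact sSup_le fun W hW w hw => Submodule.subset_span ⟨W, hW, hw⟩
  obtain ⟨t, hts, hspan, hli⟩ := exists_linearIndependent ℂ s
  let b := Module.Basis.mk hli (by rw [Subtype.range_coe, hspan, hs])
  let e := b.indexEquiv (Pi.basisFun ℂ (Config n d))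
  have hmem : ∀ i, (b.reindex e) i ∈ s := fun i => by
    rw [Module.Basis.reindex_apply, Module.Basis.mk_apply]
    exact hts (e.symm i).2
  choose W hW using hmem
  exact ⟨b.reindex e, W, hW⟩

/-- An isotypic projection is nonzero, so it does not kill all basis vectors, and its label is that
of one of them. -/
theorem finite_isotypicProj (n d : ℕ) :
    {P : Matrix (Config n d) (Config n d) ℂ | ∃ W, IsIrred W ∧ isotypicProj W = P}.Finite := by
  obtain ⟨b, W, hbW⟩ := exists_basis_isIrred n d
  refine (Set.finite_range fun i => isotypicProj (W i)).subset ?_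
  rintro _ ⟨X, hX, rfl⟩
  by_contra h
  have h0 : (isotypicProj X).mulVecLin = 0 := b.ext fun i => by
    rcases hX.isotypicProj_mulVec (hbW i).1 (hbW i).2 with h1 | h1
    · exact absurd ⟨i, h1.2.symm⟩ h
    · exact h1.1
  obtain ⟨w, hw, hw0⟩ := hX.exists_mem_ne_zero
  apply hw0
  rw [← isotypicProj_mulVec_of_mem hw]
  exact LinearMap.congr_fun h0 w

/-- The matrix which multiplies the isotypic component with projection `P` by the phase `ζ P`. -/
def phaseMatrix (n d : ℕ) (ζ : Matrix (Config n d) (Config n d) ℂ → ℂ) :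
    Matrix (Config n d) (Config n d) ℂ :=
  ∑ P ∈ (finite_isotypicProj n d).toFinset, ζ P • P

variable {ζ : Matrix (Config n d) (Config n d) ℂ → ℂ}

theorem phaseMatrix_mulVec {W : Submodule ℂ (Config n d → ℂ)} (hW : IsIrred W) {w} (hw : w ∈ W) :
    (phaseMatrix n d ζ).mulVec w = ζ (isotypicProj W) • w := by
  rw [phaseMatrix, Matrix.sum_mulVec, Finset.sum_eq_single (isotypicProj W)]
  · rw [Matrix.smul_mulVec, isotypicProj_mulVec_of_mem hw]
  · intro P hP hne
    obtain ⟨X, hX, rfl⟩ := (Set.Finite.mem_toFinset _).mp hP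
    rcases hX.isotypicProj_mulVec hW hw with h | h
    · exact absurd h.2 hne
    · rw [Matrix.smul_mulVec, h.1, smul_zero]
  · intro h
    exact absurd ((Set.Finite.mem_toFinset (finite_isotypicProj n d)).mpr ⟨W, hW, rfl⟩) h

theorem commute_phaseMatrix {T : Matrix (Config n d) (Config n d) ℂ} (hT : Equivariant T) :
    Commute (phaseMatrix n d ζ) T := by
  refine Commute.sum_left _ _ _ fun P hP => ?_
  obtain ⟨X, hX, rfl⟩ := (Set.Finite.mem_toFinset _).mp hP
  exact (commute_isotypicProj hT).smul_left _

theorem conjTranspose_phaseMatrix :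
    (phaseMatrix n d ζ).conjTranspose = phaseMatrix n d fun P => conj (ζ P) := by
  rw [phaseMatrix, phaseMatrix, Matrix.conjTranspose_sum]
  refine Finset.sum_congr rfl fun P hP => ?_
  obtain ⟨X, hX, rfl⟩ := (Set.Finite.mem_toFinset _).mp hP
  rw [Matrix.conjTranspose_smul]
  exact congrArg (conj (ζ (isotypicProj X)) • ·) (orthProj_isHermitian (isotypicHull X)).eq

theorem phaseMatrix_mem_unitaryGroup (hζ : ∀ P, ‖ζ P‖ = 1) :
    phaseMatrix n d ζ ∈ Matrix.unitaryGroup (Config n d) ℂ := by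
  rw [Matrix.mem_unitaryGroup_iff, Matrix.star_eq_conjTranspose, conjTranspose_phaseMatrix]
  refine eq_of_mulVec_eq_on_isIrred fun W hW w hw => ?_
  rw [← Matrix.mulVec_mulVec, phaseMatrix_mulVec hW hw, Matrix.mulVec_smul,
    phaseMatrix_mulVec hW hw, smul_smul, Matrix.one_mulVec, mul_comm, Complex.mul_conj,
    Complex.normSq_eq_norm_sq, hζ]
  simp

/-- `phaseMatrix` as a unitary. -/
def phaseUnitary (ζ : Matrix (Config n d) (Config n d) ℂ → ℂ) (hζ : ∀ P, ‖ζ P‖ = 1) :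
    Matrix.unitaryGroup (Config n d) ℂ :=
  ⟨phaseMatrix n d ζ, phaseMatrix_mem_unitaryGroup hζ⟩

theorem phaseUnitary_mem_symmetricUnitaries (hζ : ∀ P, ‖ζ P‖ = 1) :
    phaseUnitary ζ hζ ∈ symmetricUnitaries n d :=
  mem_symmetricUnitaries_iff.mpr fun _ hT => commute_phaseMatrix hT

theorem phaseMatrix_mul_hasDetOneOn {W : Submodule ℂ (Config n d → ℂ)} (hW : IsIrred W)
    {U : Matrix (Config n d) (Config n d) ℂ} (hU : ∀ v ∈ W, Matrix.toLin' U v ∈ W)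
    (h : ζ (isotypicProj W) ^ Module.finrank ℂ W *
      LinearMap.det ((Matrix.toLin' U).restrict hU) = 1) :
    HasDetOneOn W (phaseMatrix n d ζ * U) := by
  have hmul : ∀ v ∈ W, Matrix.toLin' (phaseMatrix n d ζ * U) v =
      ζ (isotypicProj W) • Matrix.toLin' U v := fun v hv => by
    rw [Matrix.toLin'_mul, LinearMap.comp_apply, Matrix.toLin'_apply (phaseMatrix n d ζ),
      phaseMatrix_mulVec hW (hU v hv)]
  refine ⟨fun v hv => by rw [hmul v hv]; exact W.smul_mem _ (hU v hv), ?_⟩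
  rw [← h, ← LinearMap.det_smul]
  congr 1
  ext v : 2
  exact hmul v v.2

theorem phaseUnitary_mem_specialSymmetricUnitaries (hζ : ∀ P, ‖ζ P‖ = 1)
    (h : ∀ W : Submodule ℂ (Config n d → ℂ), IsIrred W →
      ζ (isotypicProj W) ^ Module.finrank ℂ W = 1) :
    phaseUnitary ζ hζ ∈ specialSymmetricUnitaries n d := by
  refine ⟨phaseUnitary_mem_symmetricUnitaries hζ, fun W hW => ?_⟩
  have hW' := isIrred_of_isIrreducible W hW
  have h1 : phaseMatrix n d ζ = phaseMatrix n d ζ * 1 := (Matrix.mul_one _).symm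
  change HasDetOneOn W.toSubmodule (phaseMatrix n d ζ)
  obtain ⟨h2, h3⟩ := HasDetOneOn.one (W := W.toSubmodule)
  rw [h1]
  exact phaseMatrix_mul_hasDetOneOn hW' h2 (by rw [h3, mul_one, h _ hW'])

variable {U : Matrix.unitaryGroup (Config n d) ℂ}

theorem toLin'_mem_of_mem_symmetricUnitaries (hU : U ∈ symmetricUnitaries n d)
    {W : Submodule ℂ (Config n d → ℂ)} (hW : IsIrred W) :
    ∀ v ∈ W, Matrix.toLin' (U : Matrix (Config n d) (Config n d) ℂ) v ∈ W := fun v hv => by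
  rw [Matrix.toLin'_apply]
  exact hW.stable.mulVec_mem_of_commute (mem_symmetricUnitaries_iff.mp hU) hv

theorem det_restrict_eq_of_related (hU : U ∈ symmetricUnitaries n d)
    {W W' : Submodule ℂ (Config n d → ℂ)} (hW : IsIrred W) (hW' : IsIrred W')
    (h : Related W W') :
    LinearMap.det ((Matrix.toLin' (U : Matrix (Config n d) (Config n d) ℂ)).restrict
      (toLin'_mem_of_mem_symmetricUnitaries hU hW)) =
    LinearMap.det ((Matrix.toLin' (U : Matrix (Config n d) (Config n d) ℂ)).restrict
      (toLin'_mem_of_mem_symmetricUnitaries hU hW')) := by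
  obtain ⟨S, e, hS, he⟩ := hW.exists_equiv_of_related hW' h
  rw [← LinearMap.det_conj _ e]
  congr 1
  ext w : 2
  have hcomm := (mem_symmetricUnitaries_iff.mp hU S hS).eq
  have hw : (w : Config n d → ℂ) = S.mulVec (e.symm w) := by rw [← he, e.apply_symm_apply]
  change (e _ : Config n d → ℂ) = Matrix.toLin' (U : Matrix (Config n d) (Config n d) ℂ) w
  rw [he, hw]
  change S.mulVec (Matrix.toLin' (U : Matrix (Config n d) (Config n d) ℂ) (e.symm w)) = _
  rw [Matrix.toLin'_apply, Matrix.toLin'_apply, Matrix.mulVec_mulVec, Matrix.mulVec_mulVec, hcomm]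

/-- Every symmetric unitary becomes special after multiplication with suitable phases. -/
theorem exists_phaseUnitary_mul_mem (hU : U ∈ symmetricUnitaries n d) :
    ∃ (ζ : Matrix (Config n d) (Config n d) ℂ → ℂ) (hζ : ∀ P, ‖ζ P‖ = 1),
      phaseUnitary ζ hζ * U ∈ specialSymmetricUnitaries n d := by
  -- One phase serves all irreducible subspaces with label `P`: they are isomorphic, so they have
  -- the same dimension and `U` has the same determinant on each.
  have hroot : ∀ P : Matrix (Config n d) (Config n d) ℂ, ∃ z : ℂ, ‖z‖ = 1 ∧
      ∀ (W : Submodule ℂ (Config n d → ℂ)) (hW : IsIrred W), isotypicProj W = P →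
        z ^ Module.finrank ℂ W * LinearMap.det ((Matrix.toLin'
          (U : Matrix (Config n d) (Config n d) ℂ)).restrict
          (toLin'_mem_of_mem_symmetricUnitaries hU hW)) = 1 := by
    intro P
    by_cases hP : ∃ W, IsIrred W ∧ isotypicProj W = P
    · obtain ⟨X, hX, rfl⟩ := hP
      have hnt : Nontrivial X := Submodule.nontrivial_iff_ne_bot.mpr hX.ne_bot
      have hpos : 0 < Module.finrank ℂ X := Module.finrank_pos
      have hnorm := norm_det_restrict_eq_one U.2 (toLin'_mem_of_mem_symmetricUnitaries hU hX)
      set D := LinearMap.det ((Matrix.toLin'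
          (U : Matrix (Config n d) (Config n d) ℂ)).restrict
          (toLin'_mem_of_mem_symmetricUnitaries hU hX)) with hD
      have hD0 : D ≠ 0 := fun h => by simp [h] at hnorm
      obtain ⟨z, hz⟩ := IsAlgClosed.exists_pow_nat_eq D⁻¹ hpos
      refine ⟨z, ?_, fun W hW hWX => ?_⟩
      · have h1 := congrArg norm hz
        rw [norm_pow, norm_inv, hnorm, inv_one] at h1
        exact (pow_eq_one_iff_of_nonneg (norm_nonneg _) hpos.ne').mp h1
      · have hrel : Related W X := hX.related_of_isotypicProj_eq hWX
        obtain ⟨S, e, -, -⟩ := hW.exists_equiv_of_related hX hrel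
        rw [det_restrict_eq_of_related hU hW hX hrel, e.finrank_eq, hz, ← hD,
          inv_mul_cancel₀ hD0]
    · exact ⟨1, norm_one, fun W hW h => absurd ⟨W, hW, h⟩ hP⟩
  choose ζ hζ hdet using hroot
  refine ⟨ζ, hζ, mul_mem (phaseUnitary_mem_symmetricUnitaries hζ) hU, fun W hW => ?_⟩
  have hW' := isIrred_of_isIrreducible W hW
  exact phaseMatrix_mul_hasDetOneOn hW' (toLin'_mem_of_mem_symmetricUnitaries hU hW')
    (hdet _ _ hW' rfl)

end Phases

/-! ### Invariance of moment operators -/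

section Moments

variable {ι : Type*} (k : ℕ)

/-- The integrand `U^{⊗ k} ⊗ Ū^{⊗ k}` of the moment operator. -/
def momentMatrix (U : Matrix ι ι ℂ) :
    Matrix ((Fin k → ι) × (Fin k → ι)) ((Fin k → ι) × (Fin k → ι)) ℂ :=
  tensorPower k U ⊗ₖ tensorPower k (U.map conj)

theorem momentMatrix_diagonal [DecidableEq ι] (c : ι → ℂ) :
    momentMatrix k (Matrix.diagonal c) =
      Matrix.diagonal fun x => (∏ l, c (x.1 l)) * ∏ l, conj (c (x.2 l)) := by
  rw [momentMatrix, Matrix.diagonal_map (map_zero _), tensorPower_diagonal, tensorPower_diagonal,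
    Matrix.diagonal_kronecker_diagonal]

theorem momentMatrix_one [DecidableEq ι] : momentMatrix k (1 : Matrix ι ι ℂ) = 1 := by
  rw [← Matrix.diagonal_one, momentMatrix_diagonal]
  simp

variable [Fintype ι]

theorem momentMatrix_mul (U V : Matrix ι ι ℂ) :
    momentMatrix k (U * V) = momentMatrix k U * momentMatrix k V := by
  rw [momentMatrix, momentMatrix, momentMatrix, Matrix.map_mul, tensorPower_mul, tensorPower_mul,
    Matrix.mul_kronecker_mul]

variable [DecidableEq ι] (G : Subgroup (Matrix.unitaryGroup ι ℂ)) [CompactSpace G]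

instance isHaarMeasure_haarProb : (haarProb G).IsHaarMeasure :=
  MeasureTheory.Measure.isHaarMeasure_haarMeasure _

instance isProbabilityMeasure_haarProb : MeasureTheory.IsProbabilityMeasure (haarProb G) :=
  ⟨MeasureTheory.Measure.haarMeasure_self⟩

/-- Compact groups are unimodular: a right translate of the measure is again a Haar probability
measure, and this is unique. -/
instance isMulRightInvariant_haarProb : (haarProb G).IsMulRightInvariant := by
  refine ⟨fun g => ?_⟩
  have := (MeasureTheory.Measure.isProbabilityMeasure_map (μ := haarProb G)
    (measurable_mul_const g).aemeasurable)
  exact MeasureTheory.Measure.isHaarMeasure_eq_of_isProbabilityMeasure _ _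

theorem momentOperator_apply (a b) :
    momentOperator k G a b = ∫ U : G, momentMatrix k (U : Matrix ι ι ℂ) a b ∂(haarProb G) := rfl

theorem integrable_momentMatrix (a b) :
    MeasureTheory.Integrable (fun U : G => momentMatrix k (U : Matrix ι ι ℂ) a b)
      (haarProb G) := by
  have hcont : Continuous fun U : G => momentMatrix k (U : Matrix ι ι ℂ) a b := by
    have hentry : ∀ i j, Continuous fun U : G => (U : Matrix ι ι ℂ) i j := fun i j =>
      (continuous_subtype_val.comp continuous_subtype_val).matrix_elem i j
    simp only [momentMatrix, Matrix.kroneckerMap_apply, tensorPower, Matrix.of_apply,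
      Matrix.map_apply]
    exact (continuous_finsetProd _ fun l _ => hentry _ _).mul
      (continuous_finsetProd _ fun l _ => Complex.continuous_conj.comp (hentry _ _))
  exact hcont.integrable_of_hasCompactSupport (HasCompactSupport.of_compactSpace _)

theorem mul_momentOperator_apply
    (A : Matrix ((Fin k → ι) × (Fin k → ι)) ((Fin k → ι) × (Fin k → ι)) ℂ) (a b) :
    (A * momentOperator k G) a b =
      ∫ U : G, (A * momentMatrix k (U : Matrix ι ι ℂ)) a b ∂(haarProb G) := by
  simp only [Matrix.mul_apply, momentOperator_apply]
  rw [MeasureTheory.integral_finsetSum _ fun c _ =>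
    (integrable_momentMatrix k G c b).const_mul (A a c)]
  exact Finset.sum_congr rfl fun c _ => (MeasureTheory.integral_const_mul _ _).symm

theorem momentOperator_mul_apply
    (A : Matrix ((Fin k → ι) × (Fin k → ι)) ((Fin k → ι) × (Fin k → ι)) ℂ) (a b) :
    (momentOperator k G * A) a b =
      ∫ U : G, (momentMatrix k (U : Matrix ι ι ℂ) * A) a b ∂(haarProb G) := by
  simp only [Matrix.mul_apply, momentOperator_apply]
  rw [MeasureTheory.integral_finsetSum _ fun c _ =>
    (integrable_momentMatrix k G a c).mul_const (A c b)]
  exact Finset.sum_congr rfl fun c _ => (MeasureTheory.integral_mul_const _ _).symm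

theorem momentOperator_mul_momentMatrix {V : Matrix.unitaryGroup ι ℂ} (hV : V ∈ G) :
    momentOperator k G * momentMatrix k (V : Matrix ι ι ℂ) = momentOperator k G := by
  ext a b
  rw [momentOperator_mul_apply, momentOperator_apply]
  simp only [← momentMatrix_mul]
  exact MeasureTheory.integral_mul_right_eq_self
    (fun U : G => momentMatrix k (U : Matrix ι ι ℂ) a b) ⟨V, hV⟩

theorem momentMatrix_mul_momentOperator {V : Matrix.unitaryGroup ι ℂ} (hV : V ∈ G) :
    momentMatrix k (V : Matrix ι ι ℂ) * momentOperator k G = momentOperator k G := by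
  ext a b
  rw [mul_momentOperator_apply, momentOperator_apply]
  simp only [← momentMatrix_mul]
  exact MeasureTheory.integral_mul_left_eq_self
    (fun U : G => momentMatrix k (U : Matrix ι ι ℂ) a b) ⟨V, hV⟩

/-- The moment operators of a compact group and a subgroup agree if the moment operator of the
subgroup is invariant under the larger group. -/
theorem momentOperator_eq_of_le {H : Subgroup (Matrix.unitaryGroup ι ℂ)} [CompactSpace H]
    (hle : H ≤ G) (hinv : ∀ V ∈ G,
      momentOperator k H * momentMatrix k (V : Matrix ι ι ℂ) = momentOperator k H) :
    momentOperator k H = momentOperator k G := by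
  -- The product is evaluated twice: averaging the assumed invariance over `G` gives the moment
  -- operator of `H`, and averaging invariance under `H ≤ G` over `H` gives that of `G`.
  have h1 : momentOperator k H * momentOperator k G = momentOperator k H := by
    ext a b
    rw [mul_momentOperator_apply]
    simp only [fun U : G => hinv U U.2]
    simp
  have h2 : momentOperator k H * momentOperator k G = momentOperator k G := by
    ext a b
    rw [momentOperator_mul_apply]
    simp only [fun U : H => momentMatrix_mul_momentOperator k G (hle U.2)]
    simp
  exact h1.symm.trans h2

end Moments

/-! ### The moment operators of the symmetric unitaries -/

section Main

variable {n d k : ℕ}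

theorem specialSymmetricUnitaries_le (n d : ℕ) :
    specialSymmetricUnitaries n d ≤ symmetricUnitaries n d := fun _ hU => hU.1

-- The rank-one matrix `w' wᴴ` is equivariant when both vectors are fixed by `S_n`.
open scoped ComplexOrder in
theorem related_of_invariant {W W' : Submodule ℂ (Config n d → ℂ)} (hW : IsIrred W)
    (hW' : IsIrred W') (h : ∀ σ, ∀ w ∈ W, permRep n d σ w = w)
    (h' : ∀ σ, ∀ w ∈ W', permRep n d σ w = w) : Related W W' := by
  obtain ⟨w, hw, hw0⟩ := hW.exists_mem_ne_zero
  obtain ⟨w', hw', hwne⟩ := hW'.exists_mem_ne_zero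
  have hmul : ∀ v, (Matrix.vecMulVec w' (star w)).mulVec v = (star w ⬝ᵥ v) • w' := fun v => by
    rw [Matrix.vecMulVec_mulVec]
    funext x
    simp [mul_comm]
  refine ⟨Matrix.vecMulVec w' (star w), fun σ x y => ?_, fun v _ => ?_, w, hw, ?_⟩
  · rw [Matrix.vecMulVec_apply, Matrix.vecMulVec_apply, Pi.star_apply, Pi.star_apply,
      ← permRep_apply σ w, ← permRep_apply σ w', h σ w hw, h' σ w' hw']
  · rw [hmul]; exact W'.smul_mem _ hw'
  · rw [hmul]
    exact smul_ne_zero (fun h0 => hw0 (dotProduct_star_self_eq_zero.mp h0)) hwne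

/-- If a weight `∏ l, ζ (L (I l)) * ∏ l, conj (ζ (L (J l)))` is trivial on all special phases,
then every isotypic component of dimension more than `k` occurs equally often in `I` and `J`. -/
theorem card_filter_eq_of_special {α : Type*} (L : α → Matrix (Config n d) (Config n d) ℂ)
    (I J : Fin k → α)
    (h : ∀ ζ : Matrix (Config n d) (Config n d) ℂ → ℂ, (∀ P, ‖ζ P‖ = 1) →
      (∀ W : Submodule ℂ (Config n d → ℂ), IsIrred W →
        ζ (isotypicProj W) ^ Module.finrank ℂ W = 1) →
      (∏ l, ζ (L (I l))) * ∏ l, conj (ζ (L (J l))) = 1)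
    {X : Submodule ℂ (Config n d → ℂ)} (hX : IsIrred X) (hk : k < Module.finrank ℂ X) :
    (Finset.univ.filter fun l => L (I l) = isotypicProj X).card =
      (Finset.univ.filter fun l => L (J l) = isotypicProj X).card := by
  classical
  have hr0 : Module.finrank ℂ X ≠ 0 := by omega
  -- The phase `ω` on the component of `X`, and `1` elsewhere, is special. Both counts are at most
  -- `k < dim X`, the order of `ω`, so equal powers of `ω` have equal exponents.
  have hω := Complex.isPrimitiveRoot_exp (Module.finrank ℂ X) hr0
  set ω := Complex.exp (2 * Real.pi * Complex.I / (Module.finrank ℂ X : ℕ))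
  have hω1 : ‖ω‖ = 1 := hω.norm'_eq_one hr0
  have h1 := h (fun P => if P = isotypicProj X then ω else 1)
    (fun P => by split_ifs; exacts [hω1, norm_one]) (fun W hW => by
      split_ifs with he
      · obtain ⟨S, e, -, -⟩ := hW.exists_equiv_of_related hX (hX.related_of_isotypicProj_eq he)
        rw [e.finrank_eq, hω.pow_eq_one]
      · exact one_pow _)
  rw [← map_prod, prod_update_one, prod_update_one, map_pow] at h1
  set a := (Finset.univ.filter fun l => L (I l) = isotypicProj X).card
  set b := (Finset.univ.filter fun l => L (J l) = isotypicProj X).card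
  have hle : a ≤ k ∧ b ≤ k :=
    ⟨(Finset.card_le_univ _).trans (by simp), (Finset.card_le_univ _).trans (by simp)⟩
  have hωc : conj ω * ω = 1 := by
    rw [mul_comm, Complex.mul_conj, Complex.normSq_eq_norm_sq, hω1]; simp
  refine hω.pow_inj (by omega) (by omega) ?_
  calc ω ^ a = ω ^ a * (conj ω * ω) ^ b := by rw [hωc, one_pow, mul_one]
    _ = (ω ^ a * conj ω ^ b) * ω ^ b := by rw [mul_pow, mul_assoc]
    _ = ω ^ b := by rw [h1, one_mul]

/-- The fibre sizes of `f` and of `g` both add up to `card α`, so agreement off one value forces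
agreement there. This handles the one component too small for the root-of-unity test. -/
theorem card_filter_eq_of_eq_off {α β : Type*} [Fintype α] [DecidableEq β] (f g : α → β) (b₀ : β)
    (h : ∀ b, b ≠ b₀ → (Finset.univ.filter fun l => f l = b).card =
      (Finset.univ.filter fun l => g l = b).card) (b : β) :
    (Finset.univ.filter fun l => f l = b).card = (Finset.univ.filter fun l => g l = b).card := by
  by_cases hb : b = b₀
  swap
  · exact h b hb
  subst hb
  let s : Finset β := insert b (Finset.univ.image f ∪ Finset.univ.image g)
  have hf : (Finset.univ : Finset α).card = ∑ c ∈ s, (Finset.univ.filter fun l => f l = c).card :=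
    Finset.card_eq_sum_card_fiberwise fun x _ => by simp [s]
  have hg : (Finset.univ : Finset α).card = ∑ c ∈ s, (Finset.univ.filter fun l => g l = c).card :=
    Finset.card_eq_sum_card_fiberwise fun x _ => by simp [s]
  have hbs : b ∈ s := Finset.mem_insert_self _ _
  rw [← Finset.add_sum_erase _ _ hbs] at hf hg
  have he : ∑ c ∈ s.erase b, (Finset.univ.filter fun l => f l = c).card =
      ∑ c ∈ s.erase b, (Finset.univ.filter fun l => g l = c).card :=
    Finset.sum_congr rfl fun c hc => h c (Finset.ne_of_mem_erase hc)
  omega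

/-- A weight which is trivial on all special phases is trivial on all phases. -/
theorem weight_eq_one (hk : k + 1 < n) (hd : 1 ≤ k → d < n) (hn : ¬ (n = 4 ∧ k = 2))
    {α : Type*} (W : α → Submodule ℂ (Config n d → ℂ)) (hW : ∀ i, IsIrred (W i))
    (I J : Fin k → α)
    (h : ∀ ζ : Matrix (Config n d) (Config n d) ℂ → ℂ, (∀ P, ‖ζ P‖ = 1) →
      (∀ W : Submodule ℂ (Config n d → ℂ), IsIrred W →
        ζ (isotypicProj W) ^ Module.finrank ℂ W = 1) →
      (∏ l, ζ (isotypicProj (W (I l)))) * ∏ l, conj (ζ (isotypicProj (W (J l)))) = 1)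
    {ζ : Matrix (Config n d) (Config n d) ℂ → ℂ} (hζ : ∀ P, ‖ζ P‖ = 1) :
    (∏ l, ζ (isotypicProj (W (I l)))) * ∏ l, conj (ζ (isotypicProj (W (J l)))) = 1 := by
  classical
  have hinv : ∀ X : Submodule ℂ (Config n d → ℂ), IsIrred X → Module.finrank ℂ X ≤ k →
      ∀ σ, ∀ w ∈ X, permRep n d σ w = w := by
    intro X hX hXk σ w hw
    have hnt : Nontrivial X := Submodule.nontrivial_iff_ne_bot.mpr hX.ne_bot
    have hpos : 0 < Module.finrank ℂ X := Module.finrank_pos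
    -- A nonzero space of dimension at most `k` exists only for `k ≥ 1`, which is why `d < n` is
    -- needed only then.
    have hk1 : 1 ≤ k := by omega
    exact permRep_apply_eq_self hk hk1 (hd hk1) hn ⟨X, hX.stable⟩ hXk σ hw
  obtain ⟨P₀, hP₀⟩ : ∃ P₀ : Matrix (Config n d) (Config n d) ℂ,
      ∀ X : Submodule ℂ (Config n d → ℂ), IsIrred X → Module.finrank ℂ X ≤ k →
        isotypicProj X = P₀ := by
    by_cases hex : ∃ X : Submodule ℂ (Config n d → ℂ), IsIrred X ∧ Module.finrank ℂ X ≤ k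
    · obtain ⟨Y, hY, hYk⟩ := hex
      exact ⟨isotypicProj Y, fun X hX hXk => hX.isotypicProj_eq_of_related hY
        (related_of_invariant hX hY (hinv X hX hXk) (hinv Y hY hYk))⟩
    · exact ⟨0, fun X hX hXk => absurd ⟨X, hX, hXk⟩ hex⟩
  have hcount := card_filter_eq_of_eq_off (fun l => isotypicProj (W (I l)))
    (fun l => isotypicProj (W (J l))) P₀ fun P hP => by
      by_cases hex : ∃ X, IsIrred X ∧ isotypicProj X = P
      · obtain ⟨X, hX, rfl⟩ := hex
        refine card_filter_eq_of_special (fun i => isotypicProj (W i)) I J h hX ?_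
        by_contra! hle
        exact hP (hP₀ X hX hle)
      · have hempty : ∀ K : Fin k → α,
            (Finset.univ.filter fun l => isotypicProj (W (K l)) = P) = ∅ := fun K =>
          Finset.filter_eq_empty_iff.mpr fun l _ hl => hex ⟨_, hW (K l), hl⟩
        rw [hempty, hempty]
  obtain ⟨σ, hσ⟩ := exists_perm_of_card_fiber_eq _ _ hcount
  rw [← Equiv.prod_comp σ fun l => conj (ζ (isotypicProj (W (J l)))), ← Finset.prod_mul_distrib]
  refine Finset.prod_eq_one fun l _ => ?_
  rw [hσ l, Complex.mul_conj, Complex.normSq_eq_norm_sq, hζ]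
  simp

theorem momentOperator_mul_phaseMatrix (hk : k + 1 < n) (hd : 1 ≤ k → d < n)
    (hn : ¬ (n = 4 ∧ k = 2)) {ζ : Matrix (Config n d) (Config n d) ℂ → ℂ}
    (hζ : ∀ P, ‖ζ P‖ = 1) :
    momentOperator k (specialSymmetricUnitaries n d) * momentMatrix k (phaseMatrix n d ζ) =
      momentOperator k (specialSymmetricUnitaries n d) := by
  obtain ⟨b, W, hbW⟩ := exists_basis_isIrred n d
  set T := momentOperator k (specialSymmetricUnitaries n d)
  set B : Matrix (Config n d) (Config n d) ℂ := (Pi.basisFun ℂ (Config n d)).toMatrix b with hB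
  have hBB : B * b.toMatrix (Pi.basisFun ℂ (Config n d)) = 1 :=
    Module.Basis.toMatrix_mul_toMatrix_flip _ _
  set R := T * momentMatrix k B with hR
  have hdiag : ∀ ζ : Matrix (Config n d) (Config n d) ℂ → ℂ,
      phaseMatrix n d ζ * B = B * Matrix.diagonal fun i => ζ (isotypicProj (W i)) := by
    intro ζ
    ext x i
    rw [Matrix.mul_diagonal]
    have h1 := congrFun (phaseMatrix_mulVec (ζ := ζ) (hbW i).1 (hbW i).2) x
    rw [Pi.smul_apply, smul_eq_mul, mul_comm] at h1
    exact h1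
  have hRD : ∀ ζ : Matrix (Config n d) (Config n d) ℂ → ℂ,
      T * momentMatrix k (phaseMatrix n d ζ) * momentMatrix k B =
        R * momentMatrix k (Matrix.diagonal fun i => ζ (isotypicProj (W i))) := by
    intro ζ
    rw [Matrix.mul_assoc, ← momentMatrix_mul, hdiag, momentMatrix_mul, ← Matrix.mul_assoc]
  have hspecial : ∀ ζ : Matrix (Config n d) (Config n d) ℂ → ℂ, (∀ P, ‖ζ P‖ = 1) →
      (∀ W : Submodule ℂ (Config n d → ℂ), IsIrred W →
        ζ (isotypicProj W) ^ Module.finrank ℂ W = 1) →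
      R * momentMatrix k (Matrix.diagonal fun i => ζ (isotypicProj (W i))) = R := by
    intro ζ hζ h
    rw [← hRD]
    have := momentOperator_mul_momentMatrix k (specialSymmetricUnitaries n d)
      (phaseUnitary_mem_specialSymmetricUnitaries hζ h)
    exact congrArg (· * momentMatrix k B) this
  -- A nonzero entry of `R` must have trivial weight under all special phases, hence under all
  -- phases.
  have hall : R * momentMatrix k (Matrix.diagonal fun i => ζ (isotypicProj (W i))) = R := by
    ext a IJ
    rw [momentMatrix_diagonal, Matrix.mul_diagonal]
    by_cases h0 : R a IJ = 0
    · rw [h0, zero_mul]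
    rw [weight_eq_one hk hd hn W (fun i => (hbW i).1) IJ.1 IJ.2 (fun ζ hζ h => ?_) hζ, mul_one]
    have h1 := congrFun (congrFun (hspecial ζ hζ h) a) IJ
    rw [momentMatrix_diagonal, Matrix.mul_diagonal] at h1
    exact mul_left_cancel₀ h0 (h1.trans (mul_one _).symm)
  have h2 := (hRD ζ).trans (hall.trans hR)
  have h3 := congrArg (· * momentMatrix k (b.toMatrix (Pi.basisFun ℂ (Config n d)))) h2
  simpa only [Matrix.mul_assoc, ← momentMatrix_mul, hBB, momentMatrix_one, Matrix.mul_one]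
    using h3

/-- With a phase `Z` such that `ZU` is special, `T` absorbs both `ZU` and `Z`, hence `U`. -/
theorem momentOperator_mul_symmetric (hk : k + 1 < n) (hd : 1 ≤ k → d < n)
    (hn : ¬ (n = 4 ∧ k = 2)) {U : Matrix.unitaryGroup (Config n d) ℂ}
    (hU : U ∈ symmetricUnitaries n d) :
    momentOperator k (specialSymmetricUnitaries n d) *
        momentMatrix k (U : Matrix (Config n d) (Config n d) ℂ) =
      momentOperator k (specialSymmetricUnitaries n d) := by
  obtain ⟨ζ, hζ, hmem⟩ := exists_phaseUnitary_mul_mem hU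
  have h1 := momentOperator_mul_momentMatrix k (specialSymmetricUnitaries n d) hmem
  have h2 : ((phaseUnitary ζ hζ * U : Matrix.unitaryGroup (Config n d) ℂ) :
      Matrix (Config n d) (Config n d) ℂ) = phaseMatrix n d ζ * U := rfl
  rwa [h2, momentMatrix_mul, ← Matrix.mul_assoc,
    momentOperator_mul_phaseMatrix hk hd hn hζ] at h1

end Main

end SymDesign

end

theorem mainTheorem3 (n d k : ℕ) (hk : k + 1 < n) (hd : 1 ≤ k → d < n)
    (hn : ¬ (n = 4 ∧ k = 2)) :
    SymDesign.momentOperator k (SymDesign.specialSymmetricUnitaries n d) =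
      SymDesign.momentOperator k (SymDesign.symmetricUnitaries n d) := by
  exact SymDesign.momentOperator_eq_of_le k _ (SymDesign.specialSymmetricUnitaries_le n d)
    fun _ hU => SymDesign.momentOperator_mul_symmetric hk hd hn hU
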